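/- Let $\mathbb K$ be a field. A weight of rank $K$ is a labelling of the vertices $1,\dots,2K$ of the horizontal "dotted line" by $\wedge,\vee$. A block is a class of weights of a fixed rank $K$ under the equivalence relation generated by swapping neighbouring labels $\wedge,\vee$ and by exchanging $\wedge\wedge$ and $\vee\vee$ at the first two positions. A cup diagram of rank $K$ is a collection of $K$ non-crossing arcs below the dotted line whose endpoints are exactly $1,\dots,2K$, each arc being marked or unmarked, where a marked arc has to be connectable to the point $(0,0)$ below the dotted line without crossing other arcs; diagrams whose (un)marked arcs join the same points are identified. The mirror image $d^*$ of a cup diagram $d$ is a cap diagram. An oriented circle diagram $c\lambda d^*$ of a block $\Lambda$ of rank $K$ consists of cup diagrams $c,d$ of rank $K$ and a weight $\lambda\in\Lambda$ such that unmarked arcs of $c$ and $d^*$ join different labels and marked arcs join equal labels. Its degree is the number of arcs of $c$ and $d^*$ that are unmarked and labelled $\wedge\vee$ (from left to right) or marked and labelled $\vee\vee$. Let $\mathfrak A_\Lambda$ and $\overline{\mathfrak A}_\Lambda$ both be the graded $\mathbb K$-vector space with basis the oriented circle diagrams of $\Lambda$, and put $\mathfrak A=\bigoplus_\Lambda\mathfrak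 A_\Lambda$, $\overline{\mathfrak A}=\bigoplus_\Lambda\overline{\mathfrak A}_\Lambda$ (over all blocks). They carry the following bilinear multiplications (not assumed to be associative or unital); products of elements of different blocks are zero. The product of $c_b\lambda d^*$ and $d'\mu c_t^*$ is $0$ if $d\neq d'$. If $d=d'$, put $d\mu c_t^*$ on top of $c_b\lambda d^*$, and repeatedly perform a surgery at the leftmost pair of a cap of $d^*$ and the mirror image cup of $d$ which can be connected without crossing arcs and has no marked arc of the middle section to its right, until no such pairs are left: the cup and the cap (both marked or both unmarked) with left vertex $i$ and right vertex $j$ are replaced by two unmarked vertical segments at $i$ and $j$. The final diagram is $c_bc_t^*$. An orientation of a diagram is a labelling of its vertices such that unmarked arcs join different labels, and marked arcs and vertical segments join equal labels. For a circle $C$ let $\mathtt B(C)$ be its rightmost vertex; $C$ is clockwise if $\mathtt B(C)$ is labelled $\vee$, and anticlockwise otherwise. For points $k,l$ on a circle let $\mathrm{ulen}(k\to l)$ and $\mathrm{mlen}(k\to l)$ be the sums of $|p-q|$ over all unmarked, respectively marked, arcs joining $p$ and $q$ on a path from $k$ to $l$ along the circle (their parities do not depend on the path). Let $\mathrm{mtype}$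 be $1$ if the pair at which the surgery is performed is marked and $0$ if it is unmarked, and $\mathrm{utype}=1-\mathrm{mtype}$. Circles not involved in a surgery keep their orientation, and if the diagram after the surgery has no orientation, the result is $0$. Otherwise: **Merge** of two circles into $C_{\mathrm{af}}$. If both are anticlockwise, $C_{\mathrm{af}}$ is anticlockwise and the sign is $+1$. If both are clockwise, the result is $0$. If exactly one of them, $C$, is clockwise, $C_{\mathrm{af}}$ is clockwise and the sign is $(-1)^{\mathrm{ulen}(\mathtt B(C)\to\mathtt B(C_{\mathrm{af}}))}$ in $\mathfrak A$ and $(-1)^{\mathrm{mlen}(\mathtt B(C)\to\mathtt B(C_{\mathrm{af}}))}$ in $\overline{\mathfrak A}$. **Split** of $C_{\mathrm{be}}$ into $C_i\ni i$ and $C_j\ni j$; write $\mathtt B_{\mathrm{be}},\mathtt B_i,\mathtt B_j$ for the base points. If $C_{\mathrm{be}}$ is anticlockwise, the result is the sum of two terms, one with $C_i$ clockwise and $C_j$ anticlockwise, the other with $C_j$ clockwise and $C_i$ anticlockwise. If $C_{\mathrm{be}}$ is clockwise, the result is the term with $C_i$ and $C_j$ clockwise. The signs of these terms are as follows. - In $\mathfrak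 A$: $(-1)^{\mathrm{ulen}(i\to\mathtt B_i)+\mathrm{utype}+i}$ if only $C_i$ is clockwise, $(-1)^{\mathrm{ulen}(j\to\mathtt B_j)+i}$ if only $C_j$ is clockwise, and $(-1)^{\mathrm{ulen}(\mathtt B_{\mathrm{be}}\to\mathtt B_j)+\mathrm{ulen}(i\to\mathtt B_i)+\mathrm{utype}+i}$ if both are clockwise. - In $\overline{\mathfrak A}$: $\varepsilon_i(-1)^{\mathrm{mlen}(i\to\mathtt B_i)}$ if only $C_i$ is clockwise and $\varepsilon_j(-1)^{\mathrm{mlen}(j\to\mathtt B_j)}$ if only $C_j$ is clockwise, where $\varepsilon_i=(-1)^{\mathrm{mtype}}$ if $C_j$ is nested in $C_i$ and $\varepsilon_i=1$ otherwise, and $\varepsilon_j=(-1)^{\mathrm{mtype}}$ if $C_i$ is nested in $C_j$ and $\varepsilon_j=1$ otherwise. If both are clockwise: $(-1)^{\mathrm{mlen}(j\to\mathtt B_j)}$ if $C_j$ is nested in $C_i$, $(-1)^{\mathrm{mlen}(i\to\mathtt B_i)}$ if $C_i$ is nested in $C_j$, and, if neither is nested in the other, $(-1)^{\mathrm{mlen}(x\to\mathtt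 B_x)}$, where $x\in\{i,j\}$ is such that $C_x$ does not contain $\mathtt B_{\mathrm{be}}$. **Proposition.** There is an isomorphism of graded $\mathbb K$-algebras $\mathtt{sign}\colon\mathfrak A\to\overline{\mathfrak A}$ (a bijective $\mathbb K$-linear multiplicative map that sends the homogeneous part of degree $n$ onto the homogeneous part of degree $n$, for every $n\in\mathbb Z$), given on the basis by $$\mathtt{sign}(c\lambda d^*)=\Bigl(\prod_{C}\mathrm{coeff}_C\Bigr)\,c\lambda d^*,\qquad \mathrm{coeff}_C=\begin{cases}1&\text{if }C\text{ is anticlockwise in }c\lambda d^*,\\-(-1)^{\mathtt B(C)}&\text{if }C\text{ is clockwise in }c\lambda d^*,\end{cases}$$ where $C$ runs over the circles of $cd^*$. For every block $\Lambda$, the same formula gives an isomorphism of graded algebras $\mathtt{sign}_\Lambda\colon\mathfrak A_\Lambda\to\overline{\mathfrak A}_\Lambda$. -/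

import Mathlib

namespace TypeD

/-! ## Weights and blocks -/

/-- The two symbols by which vertices are labelled: `wedge` is `∧`, `vee` is `∨`. -/
inductive Label where
  | wedge
  | vee
  deriving DecidableEq

instance : Fintype Label := ⟨{.wedge, .vee}, fun x => by cases x <;> decide⟩

/-- Interchange `∧` and `∨`. -/
def Label.flip : Label → Label
  | .wedge => .vee
  | .vee => .wedge

/-- A weight of rank `K`: a labelling of the `2K` vertices. The vertex `i`,
`1 ≤ i ≤ 2K`, is the element `i - 1` of `Fin (2 * K)`; see `vertexNumber`. -/
abbrev Weight (K : ℕ) := Fin (2 * K) → Label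

/-- The vertex in `{1, …, 2K}` that an element of `Fin (2 * K)` stands for. -/
def vertexNumber {K : ℕ} (i : Fin (2 * K)) : ℕ := i.val + 1

/-- The basic linkage moves: swap two neighbouring labels `∧` and `∨`, or exchange the pairs
`∧∧` and `∨∨` at the first two positions. -/
inductive LinkageMove {K : ℕ} : Weight K → Weight K → Prop
  | swap (w : Weight K) (i j : Fin (2 * K)) (hij : j.val = i.val + 1) (hne : w i ≠ w j) :
      LinkageMove w (w ∘ Equiv.swap i j)
  | flip (w : Weight K) (i j : Fin (2 * K)) (hi : i.val = 0) (hj : j.val = 1) (heq : w i = w j) :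
      LinkageMove w (fun k => if k.val < 2 then (w k).flip else w k)

/-- A block: a rank `K` together with a class of weights of rank `K` for the equivalence relation
generated by the basic linkage moves. -/
abbrev Block := Σ K : ℕ, Quot (LinkageMove (K := K))

/-! ## Cup diagrams and oriented circle diagrams -/

/-- A (marked) cup diagram of rank `K`. -/
@[ext]
structure CupDiagram (K : ℕ) where
  /-- The other endpoint of the arc that ends at a given vertex. -/
  partner : Fin (2 * K) → Fin (2 * K)
  /-- Whether the arc that ends at a given vertex is marked. -/
  marked : Fin (2 * K) → Bool
  partner_partner : ∀ i, partner (partner i) = i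
  partner_ne : ∀ i, partner i ≠ i
  marked_partner : ∀ i, marked (partner i) = marked i
  /-- The arcs do not cross. -/
  noncrossing : ∀ i k, i < k → k < partner i → i < partner k ∧ partner k < partner i
  /-- Admissibility: a marked arc can be joined, below the dotted line and without crossing
  another arc, to the point `(0, 0)` left of all vertices; so it lies below no other arc. -/
  admissible : ∀ i k, marked i = true → ¬ (k < i ∧ i < partner k)
  deriving DecidableEq

/-- The weight `w` orients the cup diagram `c` (equivalently the cap diagram `c^*`): unmarked arcs
join an `∧` and a `∨`, marked arcs join two equal labels. -/
def CupDiagram.OrientedBy {K : ℕ} (c : CupDiagram K) (w : Weight K) : Prop :=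
  ∀ i, if c.marked i then w (c.partner i) = w i else w (c.partner i) ≠ w i

instance {K : ℕ} (c : CupDiagram K) (w : Weight K) : Decidable (c.OrientedBy w) :=
  inferInstanceAs (Decidable (∀ i, if c.marked i then w (c.partner i) = w i
    else w (c.partner i) ≠ w i))

/-- The degree of an oriented cup (or cap) diagram: an unmarked arc has degree `0` if it is
labelled `∨∧` from left to right, and `1` if it is labelled `∧∨`; a marked arc has degree `0` if it
is labelled `∧∧`, and `1` if it is labelled `∨∨`. In all cases the degree is `1` exactly
if the right endpoint of the arc is labelled `∨`. -/
def CupDiagram.degree {K : ℕ} (c : CupDiagram K) (w : Weight K) : ℕ :=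
  ∑ i : Fin (2 * K), if i < c.partner i ∧ w (c.partner i) = Label.vee then 1 else 0

/-- An oriented circle diagram `c w d^*` with `w` in the block `B`. -/
@[ext]
structure OrientedCircleDiagram (B : Block) where
  cup : CupDiagram B.1
  cap : CupDiagram B.1
  weight : Weight B.1
  weight_mem : Quot.mk LinkageMove weight = B.2
  cup_oriented : cup.OrientedBy weight
  cap_oriented : cap.OrientedBy weight

/-- The degree of an oriented circle diagram. -/
def OrientedCircleDiagram.degree {B : Block} (x : OrientedCircleDiagram B) : ℕ :=
  x.cup.degree x.weight + x.cap.degree x.weight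

/-! ## Closed diagrams, their circles and orientations -/

/-- The two directions in which one can leave a vertex: below or above its dotted line. -/
inductive Side where
  | below
  | above
  deriving DecidableEq

instance : Fintype Side := ⟨{.below, .above}, fun x => by cases x <;> decide⟩

/-- The opposite direction. -/
def Side.opp : Side → Side
  | .below => .above
  | .above => .below

/-- The kinds of strands: unmarked arcs, marked arcs, vertical line segments. -/
inductive StrandKind where
  | unmarked
  | marked
  | vertical
  deriving DecidableEq

/-- The combinatorial data of a closed diagram with vertex set `V`: from each vertex one strand
leaves below the dotted line and one above. The order of `V` is from left to right (and from bottom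
to top between vertices with the same number). -/
structure Diagram (V : Type) where
  /-- The number of a vertex on its dotted line. -/
  num : V → ℕ
  /-- The other endpoint of a strand. -/
  nbr : Side → V → V
  /-- The kind of a strand. -/
  kind : Side → V → StrandKind

namespace Diagram

variable {V : Type} [Fintype V] [LinearOrder V] (D : Diagram V)

/-- Follow the strand that leaves the vertex `p.1` on the side `p.2`. The result is the vertex at
its other end and the side on which the curve goes on from there: the curve passes from one side
of the dotted line to the other at every vertex, a cup or cap comes back to the side from which it
started, and a vertical segment arrives from the opposite side. -/
def next (p : V × Side) : V × Side :=
  (D.nbr p.2 p.1, if D.kind p.2 p.1 = .vertical then p.2 else p.2.opp)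

/-- The set of vertices of the circle through `v`. -/
def circle (v : V) : Finset V :=
  (Finset.range (Fintype.card V)).image fun n => (D.next^[n] (v, .below)).1

theorem self_mem_circle (v : V) : v ∈ D.circle v :=
  Finset.mem_image.2 ⟨0, Finset.mem_range.2 (Fintype.card_pos_iff.2 ⟨v⟩), rfl⟩

/-- The base point of the circle through `v`: its rightmost vertex. -/
def base (v : V) : V := (D.circle v).max' ⟨v, D.self_mem_circle v⟩

/-- The set of circles, each given by its set of vertices. -/
def circles : Finset (Finset V) := Finset.univ.image D.circle

/-- A labelling `o` of the vertices is an orientation if unmarked arcs join different labels,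
and marked arcs and vertical segments join equal labels. -/
def IsOrientation (o : V → Label) : Prop :=
  ∀ s v, if D.kind s v = .unmarked then o (D.nbr s v) ≠ o v else o (D.nbr s v) = o v

instance (o : V → Label) : Decidable (D.IsOrientation o) :=
  inferInstanceAs (Decidable (∀ s v, if D.kind s v = .unmarked then o (D.nbr s v) ≠ o v
    else o (D.nbr s v) = o v))

/-- The circle through `v` is clockwise if its rightmost vertex is labelled `∨`; otherwise it
is anticlockwise. -/
def Clockwise (o : V → Label) (v : V) : Prop := o (D.base v) = .vee

instance (o : V → Label) (v : V) : Decidable (D.Clockwise o v) :=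
  inferInstanceAs (Decidable (o (D.base v) = .vee))

/-- The total length of the strands of kind `k` met on the first `n` strands of the curve that
starts in `p`, where one stops as soon as the vertex `y` is reached. The length of an arc with
endpoints `i` and `j` is `|i - j|`. -/
def lengthAux (k : StrandKind) (y : V) : ℕ → V × Side → ℕ
  | 0, _ => 0
  | n + 1, p =>
    if p.1 = y then 0
    else (if D.kind p.2 p.1 = k then Nat.dist (D.num p.1) (D.num (D.nbr p.2 p.1)) else 0) +
      lengthAux k y n (D.next p)

/-- The sum of the lengths of the arcs of kind `k` on a path from `x` to `y` along the circle that
contains both: the path that leaves `x` below the dotted line and stops at `y`. (On a circle with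
an even number of markers the parity does not depend on the choice of the path.) -/
def length (k : StrandKind) (x y : V) : ℕ := D.lengthAux k y (Fintype.card V) (x, .below)

/-- The sign `(-1)^{ulen}`, where `ulen` is the unmarked length of a path from `x` to `y`. -/
def unmarkedSign (x y : V) : ℤ := (-1) ^ D.length .unmarked x y

/-- The sign `(-1)^{mlen}`, where `mlen` is the marked length of a path from `x` to `y`. -/
def markedSign (x y : V) : ℤ := (-1) ^ D.length .marked x y

/-- The contribution of the circle with vertex set `C` to the rescaling: `1` if `C` is
anticlockwise, and `-(-1)^{B(C)}` if it is clockwise. -/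
def circleCoeff (o : V → Label) (C : Finset V) : ℤ :=
  if h : C.Nonempty then
    (if o (C.max' h) = .vee then -(-1) ^ D.num (C.max' h) else 1)
  else 1

/-- The product of the contributions of all circles. -/
def coeff (o : V → Label) : ℤ := ∏ C ∈ D.circles, D.circleCoeff o C

end Diagram

/-- The kind of the arc at the vertex `i`. -/
def CupDiagram.kind {K : ℕ} (c : CupDiagram K) (i : Fin (2 * K)) : StrandKind :=
  if c.marked i then .marked else .unmarked

/-- The circle diagram `c d^*`. -/
def circleDiagram {K : ℕ} (c d : CupDiagram K) : Diagram (Fin (2 * K)) where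
  num := vertexNumber
  nbr
    | .below, i => c.partner i
    | .above, i => d.partner i
  kind
    | .below, i => c.kind i
    | .above, i => d.kind i

/-! ## Stacked circle diagrams and surgeries -/

/-- A stacked circle diagram: the diagram `mid top^*` put on top of `bot mid^*`, where the middle
section `mid^* mid` has already been replaced by vertical segments at the vertices in `cut`. -/
structure Stacked (K : ℕ) where
  bot : CupDiagram K
  mid : CupDiagram K
  top : CupDiagram K
  cut : Finset (Fin (2 * K))

/-- The vertices of a stacked diagram of rank `K`: vertex number and dotted line, where `false`
is the lower and `true` the upper line; ordered by the vertex number first. -/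
abbrev StackedVertex (K : ℕ) := Fin (2 * K) ×ₗ Bool

/-- The vertex `i` on the lower dotted line. -/
def lo {K : ℕ} (i : Fin (2 * K)) : StackedVertex K := toLex (i, false)

/-- The vertex `i` on the upper dotted line. -/
def up {K : ℕ} (i : Fin (2 * K)) : StackedVertex K := toLex (i, true)

/-- Assemble data on the lower line and data on the upper line. -/
def glue {K : ℕ} {α : Type} (f g : Fin (2 * K) → α) (v : StackedVertex K) : α :=
  match ofLex v with
  | (i, false) => f i
  | (i, true) => g i

namespace Stacked

variable {K : ℕ} (S : Stacked K)

/-- The stacked diagram as a closed diagram. -/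
def diagram : Diagram (StackedVertex K) where
  num v := vertexNumber (ofLex v).1
  nbr
    | .below => glue (fun i => lo (S.bot.partner i))
        (fun i => if i ∈ S.cut then lo i else up (S.mid.partner i))
    | .above => glue (fun i => if i ∈ S.cut then up i else lo (S.mid.partner i))
        (fun i => up (S.top.partner i))
  kind
    | .below => glue (fun i => S.bot.kind i)
        (fun i => if i ∈ S.cut then .vertical else S.mid.kind i)
    | .above => glue (fun i => if i ∈ S.cut then .vertical else S.mid.kind i)
        (fun i => S.top.kind i)

/-- `i` is the left vertex of a cup-cap pair in the middle section which can be connected without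
crossing any arc, and such that no arc of the middle section to the right of it is marked. -/
def Available (i : Fin (2 * K)) : Prop :=
  i ∉ S.cut ∧ i < S.mid.partner i ∧
    (∀ k, k ∉ S.cut → ¬ (k < i ∧ i < S.mid.partner k)) ∧
    ∀ k, k ∉ S.cut → S.mid.partner i < k → S.mid.marked k = false

instance (i : Fin (2 * K)) : Decidable (S.Available i) :=
  inferInstanceAs (Decidable (i ∉ S.cut ∧ i < S.mid.partner i ∧
    (∀ k, k ∉ S.cut → ¬ (k < i ∧ i < S.mid.partner k)) ∧
    ∀ k, k ∉ S.cut → S.mid.partner i < k → S.mid.marked k = false))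

/-- The left vertex of the leftmost available cup-cap pair, if there is one. -/
def leftmost : Option (Fin (2 * K)) :=
  (List.finRange (2 * K)).find? fun i => decide (S.Available i)

/-- The surgery at the pair with left vertex `i` and right vertex `S.mid.partner i`: the cup and
the cap, marked or not, are replaced by two (unmarked) vertical segments. -/
def surgery (i : Fin (2 * K)) : Stacked K :=
  { S with cut := S.cut ∪ {i, S.mid.partner i} }

/-- The circle through `x` is nested in the circle through `y` (for `x` not on the latter): the part
left of `x` of the dotted line on which `x` lies meets the circle of `y` in an odd number of
points. -/
def Nested (x y : StackedVertex K) : Prop :=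
  Odd ((S.diagram.circle y).filter fun v =>
    (ofLex v).2 = (ofLex x).2 ∧ (ofLex v).1 < (ofLex x).1).card

instance (x y : StackedVertex K) : Decidable (S.Nested x y) :=
  inferInstanceAs (Decidable (Odd _))

end Stacked

/-! ## The two sign rules -/

/-- The signs in one surgery, performed in a stacked diagram `S` at the cup-cap pair with left
vertex `i` and right vertex `j`. -/
structure SignRule where
  /-- Merge of an anticlockwise circle and a clockwise circle, where the latter contains `x`. -/
  merge {K : ℕ} (S : Stacked K) (i : Fin (2 * K)) (x : StackedVertex K) : ℤ
  /-- Split of an anticlockwise circle, summand in which `C_i` is clockwise. -/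
  splitLeft {K : ℕ} (S : Stacked K) (i : Fin (2 * K)) : ℤ
  /-- Split of an anticlockwise circle, summand in which `C_j` is clockwise. -/
  splitRight {K : ℕ} (S : Stacked K) (i : Fin (2 * K)) : ℤ
  /-- Split of a clockwise circle. -/
  splitBoth {K : ℕ} (S : Stacked K) (i : Fin (2 * K)) : ℤ

/-- The unmarked saddle type of the pair at `i`: `0` if it is marked and `1` if it is unmarked. -/
def unmarkedType {K : ℕ} (S : Stacked K) (i : Fin (2 * K)) : ℕ := if S.mid.marked i then 0 else 1

/-- The marked saddle type of the pair at `i`: `0` if it is unmarked and `1` if it is marked. -/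
def markedType {K : ℕ} (S : Stacked K) (i : Fin (2 * K)) : ℕ := if S.mid.marked i then 1 else 0

/-- The signs of the type D arc algebra. -/
def arcSigns : SignRule where
  merge S i x :=
    let E := (S.surgery i).diagram
    E.unmarkedSign (S.diagram.base x) (E.base (lo i))
  splitLeft S i :=
    let E := (S.surgery i).diagram
    E.unmarkedSign (lo i) (E.base (lo i)) * (-1) ^ unmarkedType S i * (-1) ^ vertexNumber i
  splitRight S i :=
    let E := (S.surgery i).diagram
    let j := S.mid.partner i
    E.unmarkedSign (lo j) (E.base (lo j)) * (-1) ^ vertexNumber i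
  splitBoth S i :=
    let E := (S.surgery i).diagram
    let j := S.mid.partner i
    S.diagram.unmarkedSign (S.diagram.base (lo i)) (E.base (lo j)) *
      E.unmarkedSign (lo i) (E.base (lo i)) * (-1) ^ unmarkedType S i * (-1) ^ vertexNumber i

/-- The split at the pair with left vertex `i` is nested with `C_j` inside `C_i` (the reflected
`C` shape, open to the left). -/
def IsReflectedCShape {K : ℕ} (S : Stacked K) (i : Fin (2 * K)) : Prop :=
  (S.surgery i).Nested (lo (S.mid.partner i)) (lo i)

/-- The split at the pair with left vertex `i` is nested with `C_i` inside `C_j` (the `C` shape,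
open to the right). -/
def IsCShape {K : ℕ} (S : Stacked K) (i : Fin (2 * K)) : Prop :=
  (S.surgery i).Nested (lo i) (lo (S.mid.partner i))

instance {K : ℕ} (S : Stacked K) (i : Fin (2 * K)) : Decidable (IsReflectedCShape S i) :=
  inferInstanceAs (Decidable (Stacked.Nested _ _ _))

instance {K : ℕ} (S : Stacked K) (i : Fin (2 * K)) : Decidable (IsCShape S i) :=
  inferInstanceAs (Decidable (Stacked.Nested _ _ _))

/-- The signs of the sign adjusted type D arc algebra. -/
def adjustedSigns : SignRule where
  merge S i x :=
    let E := (S.surgery i).diagram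
    E.markedSign (S.diagram.base x) (E.base (lo i))
  splitLeft S i :=
    let E := (S.surgery i).diagram
    E.markedSign (lo i) (E.base (lo i)) *
      (if IsReflectedCShape S i then (-1) ^ markedType S i else 1)
  splitRight S i :=
    let E := (S.surgery i).diagram
    let j := S.mid.partner i
    E.markedSign (lo j) (E.base (lo j)) *
      (if IsCShape S i then (-1) ^ markedType S i else 1)
  splitBoth S i :=
    let E := (S.surgery i).diagram
    let j := S.mid.partner i
    if IsReflectedCShape S i then E.markedSign (lo j) (E.base (lo j))
    else if IsCShape S i then E.markedSign (lo i) (E.base (lo i))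
    else if S.diagram.base (lo i) ∈ E.circle (lo i) then E.markedSign (lo j) (E.base (lo j))
    else E.markedSign (lo i) (E.base (lo i))

/-! ## The multiplication -/

section Multiplication

variable (σ : SignRule) {K : ℕ}

/-- The coefficient of the labelling `o'` of the diagram after the surgery at `i` in the result of
this surgery applied to the stacked diagram `S` with orientation `o`. It is zero unless `o'` is an
orientation (so the result is zero if the new diagram is not orientable) which agrees with `o` on
all circles that are not involved in the surgery. -/
def surgeryCoeff (S : Stacked K) (i : Fin (2 * K)) (o o' : StackedVertex K → Label) : ℤ :=
  let D := S.diagram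
  let E := (S.surgery i).diagram
  let j := S.mid.partner i
  if E.IsOrientation o' ∧ ∀ v, v ∉ D.circle (lo i) → v ∉ D.circle (up i) → o' v = o v then
    if up i ∈ D.circle (lo i) then
      -- Split of the circle into the circles through `i` and through `j`.
      if D.Clockwise o (lo i) then
        if E.Clockwise o' (lo i) ∧ E.Clockwise o' (lo j) then σ.splitBoth S i else 0
      else
        if E.Clockwise o' (lo i) ∧ ¬ E.Clockwise o' (lo j) then σ.splitLeft S i
        else if ¬ E.Clockwise o' (lo i) ∧ E.Clockwise o' (lo j) then σ.splitRight S i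
        else 0
    else
      -- Merge of the circles through the lower and through the upper vertex `i`.
      if D.Clockwise o (lo i) then
        if D.Clockwise o (up i) then 0
        else if E.Clockwise o' (lo i) then σ.merge S i (lo i) else 0
      else
        if D.Clockwise o (up i) then
          if E.Clockwise o' (lo i) then σ.merge S i (up i) else 0
        else
          if E.Clockwise o' (lo i) then 0 else 1
  else 0

/-- Perform (at most) `n` surgeries, each time at the leftmost available pair, starting with the
linear combination of the labellings of `S` in which `o` has the coefficient `f o`. -/
def surgeries : ℕ → Stacked K → ((StackedVertex K → Label) → ℤ) → (StackedVertex K → Label) → ℤ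
  | 0, _, f => f
  | n + 1, S, f =>
    match S.leftmost with
    | none => f
    | some i =>
      surgeries n (S.surgery i) fun o' =>
        ∑ o : StackedVertex K → Label, f o * surgeryCoeff σ S i o o'

/-- The coefficient of `c w c'^*` in the product of `c u d^*` and `d v c'^*`: the diagram `d v c'^*`
is put on top of `c u d^*` and all `K` surgeries are performed. At the end all strands of the
middle section are vertical, and both dotted lines carry the same weight. -/
def structureConstant (c d c' : CupDiagram K) (u v w : Weight K) : ℤ :=
  surgeries σ K ⟨c, d, c', ∅⟩ (fun o => if o = glue u v then 1 else 0) (glue w w)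

open Classical in
/-- The product of two oriented circle diagrams of a block `B`, with integral coefficients. -/
noncomputable def blockProduct {B : Block} (x y : OrientedCircleDiagram B) :
    OrientedCircleDiagram B →₀ ℤ :=
  if x.cap = y.cup then
    ∑ w : Weight B.1,
      if h : Quot.mk LinkageMove w = B.2 ∧ x.cup.OrientedBy w ∧ y.cap.OrientedBy w then
        Finsupp.single ⟨x.cup, y.cap, w, h.1, h.2.1, h.2.2⟩
          (structureConstant σ x.cup x.cap y.cap x.weight y.weight w)
      else 0
  else 0

open Classical in
/-- The product of two oriented circle diagrams of arbitrary blocks: it is zero for different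
blocks. -/
noncomputable def fullProduct (x y : Σ B : Block, OrientedCircleDiagram B) :
    (Σ B : Block, OrientedCircleDiagram B) →₀ ℤ :=
  if h : y.1 = x.1 then (blockProduct σ x.2 (h ▸ y.2)).embDomain (Function.Embedding.sigmaMk x.1)
  else 0

end Multiplication

/-! ## Algebras with a given basis -/

/-- The `𝕜`-vector space with basis `I`, seen as a (not necessarily associative or unital)
`𝕜`-algebra through the products `m` of the basis elements. -/
structure BasedAlgebra (𝕜 : Type*) [CommRing 𝕜] {I : Type*} (m : I → I → I →₀ ℤ) where
  /-- The coordinates of an element. -/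
  coord : I →₀ 𝕜

namespace BasedAlgebra

variable {𝕜 : Type*} [CommRing 𝕜] {I : Type*} {m : I → I → I →₀ ℤ}

theorem coord_injective : Function.Injective (coord : BasedAlgebra 𝕜 m → I →₀ 𝕜) := by
  rintro ⟨x⟩ ⟨y⟩ h
  exact congrArg mk h

/-- The bilinear extension of the products of the basis elements. -/
noncomputable def mulBilin (m : I → I → I →₀ ℤ) : (I →₀ 𝕜) →ₗ[𝕜] (I →₀ 𝕜) →ₗ[𝕜] (I →₀ 𝕜) :=
  Finsupp.linearCombination 𝕜 fun x => Finsupp.linearCombination 𝕜 fun y =>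
    (m x y).mapRange (Int.cast : ℤ → 𝕜) Int.cast_zero

instance : Zero (BasedAlgebra 𝕜 m) := ⟨⟨0⟩⟩
noncomputable instance : Add (BasedAlgebra 𝕜 m) := ⟨fun x y => ⟨x.coord + y.coord⟩⟩
noncomputable instance : Neg (BasedAlgebra 𝕜 m) := ⟨fun x => ⟨-x.coord⟩⟩
noncomputable instance : Sub (BasedAlgebra 𝕜 m) := ⟨fun x y => ⟨x.coord - y.coord⟩⟩
noncomputable instance {S : Type*} [SMulZeroClass S 𝕜] : SMul S (BasedAlgebra 𝕜 m) :=
  ⟨fun a x => ⟨a • x.coord⟩⟩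

noncomputable instance : AddCommGroup (BasedAlgebra 𝕜 m) :=
  coord_injective.addCommGroup _ rfl (fun _ _ => rfl) (fun _ => rfl) (fun _ _ => rfl)
    (fun _ _ => rfl) (fun _ _ => rfl)

/-- The coordinates, as an additive map. -/
def coordHom : BasedAlgebra 𝕜 m →+ (I →₀ 𝕜) where
  toFun := coord
  map_zero' := rfl
  map_add' _ _ := rfl

noncomputable instance : Module 𝕜 (BasedAlgebra 𝕜 m) :=
  coord_injective.module 𝕜 coordHom fun _ _ => rfl

noncomputable instance : Mul (BasedAlgebra 𝕜 m) := ⟨fun x y => ⟨mulBilin m x.coord y.coord⟩⟩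

theorem coord_mul (x y : BasedAlgebra 𝕜 m) : (x * y).coord = mulBilin m x.coord y.coord := rfl

noncomputable instance : NonUnitalNonAssocRing (BasedAlgebra 𝕜 m) where
  left_distrib x y z := coord_injective (map_add (mulBilin m x.coord) y.coord z.coord)
  right_distrib x y z := coord_injective (LinearMap.map_add₂ (mulBilin m) x.coord y.coord z.coord)
  zero_mul x := coord_injective (LinearMap.map_zero₂ (mulBilin m) x.coord)
  mul_zero x := coord_injective (map_zero (mulBilin m x.coord))

instance : IsScalarTower 𝕜 (BasedAlgebra 𝕜 m) (BasedAlgebra 𝕜 m) :=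
  ⟨fun a x y => coord_injective (LinearMap.map_smul₂ (mulBilin m) a x.coord y.coord)⟩

instance : SMulCommClass 𝕜 (BasedAlgebra 𝕜 m) (BasedAlgebra 𝕜 m) :=
  ⟨fun a x y => coord_injective (map_smul (mulBilin m x.coord) a y.coord).symm⟩

/-- The basis element with index `x`. -/
noncomputable def basisElt (x : I) : BasedAlgebra 𝕜 m := ⟨Finsupp.single x 1⟩

/-- The homogeneous part of degree `n`, if the basis element with index `x` has degree
`deg x`. -/
noncomputable def homogeneous (deg : I → ℕ) (n : ℤ) : Submodule 𝕜 (BasedAlgebra 𝕜 m) :=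
  Submodule.span 𝕜 (basisElt '' {x | (deg x : ℤ) = n})

end BasedAlgebra

/-! ## The two algebras -/

/-- The summand of the type D arc algebra that belongs to the block `B`. -/
abbrev BlockArcAlgebra (𝕜 : Type*) [Field 𝕜] (B : Block) :=
  BasedAlgebra 𝕜 (blockProduct arcSigns (B := B))

/-- The summand of the sign adjusted type D arc algebra that belongs to the block `B`. -/
abbrev AdjustedBlockArcAlgebra (𝕜 : Type*) [Field 𝕜] (B : Block) :=
  BasedAlgebra 𝕜 (blockProduct adjustedSigns (B := B))

/-- The (full) type D arc algebra, the direct sum over all blocks. -/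
abbrev ArcAlgebra (𝕜 : Type*) [Field 𝕜] := BasedAlgebra 𝕜 (fullProduct arcSigns)

/-- The (full) sign adjusted type D arc algebra. -/
abbrev AdjustedArcAlgebra (𝕜 : Type*) [Field 𝕜] := BasedAlgebra 𝕜 (fullProduct adjustedSigns)

/-- The scalar by which the basis element given by an oriented circle diagram is rescaled. -/
def OrientedCircleDiagram.signCoeff {B : Block} (x : OrientedCircleDiagram B) : ℤ :=
  (circleDiagram x.cup x.cap).coeff x.weight

end TypeD

/-! The rescaling is multiplicative because it intertwines the two sign rules one surgery at a time.
The source of this is a parity fact. By planarity every arc joins an odd vertex to an even one, so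
its length is odd. Hence along any path the unmarked length plus the marked length has the parity of
the difference of the endpoints (`unmarkedSign_mul_markedSign`), and the two sign conventions differ
by a factor depending only on endpoints. When these are base points, the factor is absorbed by the
coefficients `-(-1)^B` of the clockwise circles.

The same parity fact directs all circles coherently. Leaving even vertices upwards and odd ones
downwards defines a permutation of the vertices whose cycles are the circles. A surgery multiplies
it by a transposition (`exists_perm_surgery_eq`), so merging and splitting circles becomes merging
and splitting cycles.

Two further inputs are needed for splits. First, the nesting cases of the adjusted rule are
controlled by a discrete Jordan curve argument: an inner circle has its base point to the left of
that of the outer one (`base_lt_base_of_nested`), and a marked split always has `C_j` inside `C_i`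
(`isReflectedCShape_of_marked`). Second, when a clockwise circle is split, the unmarked length on
the old circle must be compared with lengths on the new ones. In an oriented diagram an unmarked
sign is the product of the signs of two labels (`unmarkedSign_eq`), and `sign_split` relates the
labels before and after.

The local identity `surgeryCoeff_mul_coeff` is then iterated. The total coefficient of the initial
stack is the product of the coefficients of the two factors, that of the final stack is the
coefficient of the product diagram, and an algebra map that rescales a basis by signs is its own
inverse up to identifying the bases. -/

/-! ### Cycles of a permutation multiplied by a transposition -/

open Equiv.Perm in
theorem Equiv.Perm.SameCycle.exists_pow_lt_card {α : Type*} [Fintype α] [DecidableEq α]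
    {f : Equiv.Perm α} {x y : α} (h : f.SameCycle x y) :
    ∃ n < Fintype.card α, (f ^ n) x = y := by
  by_cases hx : x ∈ f.support
  · obtain ⟨i, hi, hxy⟩ := h.exists_pow_eq_of_mem_support hx
    exact ⟨i, hi.trans_le (Finset.card_le_univ _), hxy⟩
  · refine ⟨0, Fintype.card_pos_iff.2 ⟨x⟩, ?_⟩
    exact (h.eq_of_left (by simpa [Function.IsFixedPt] using hx))

namespace Equiv.Perm

variable {α : Type*} [DecidableEq α] {f g : Perm α} {a b : α}

/-- Iterates of `f * swap a b` starting at `a` follow those of `f` starting at `b` until `a` or `b`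
is reached. -/
theorem mul_swap_pow_apply {n : ℕ} (hn : 0 < n)
    (h : ∀ m, 0 < m → m < n → (f ^ m) b ≠ a ∧ (f ^ m) b ≠ b) :
    ((f * swap a b) ^ n) a = (f ^ n) b := by
  induction n, hn using Nat.le_induction with
  | base => simp
  | succ k hk ih =>
    have hk' := h k hk (Nat.lt_succ_self k)
    rw [pow_succ', Perm.mul_apply, ih fun m h0 hm => h m h0 (hm.trans (Nat.lt_succ_self k)),
      Perm.mul_apply, swap_apply_of_ne_of_ne hk'.1 hk'.2, pow_succ', Perm.mul_apply]

/-- The `f`-orbit of `b` returns to `b` without meeting `a`; the new permutation follows it starting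
from `a`, and so ends in `b`. -/
theorem sameCycle_mul_swap_of_not [Finite α] (h : ¬ f.SameCycle a b) :
    (f * swap a b).SameCycle a b := by
  classical
  have hex : ∃ n, 0 < n ∧ (f ^ n) b = b :=
    ⟨orderOf f, orderOf_pos f, by rw [pow_orderOf_eq_one]; rfl⟩
  have h1 := Nat.find_spec hex
  refine ⟨(Nat.find hex : ℕ), ?_⟩
  rw [zpow_natCast, mul_swap_pow_apply h1.1, h1.2]
  intro m h0 hm
  refine ⟨fun e => h (SameCycle.symm ⟨m, by rw [zpow_natCast, e]⟩), fun e => ?_⟩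
  exact Nat.find_min hex hm ⟨h0, e⟩

/-- The new orbit of `a` is the stretch of the old cycle from just after `b` up to `a`. It closes up
there and never passes through `b`. -/
theorem not_sameCycle_mul_swap [Finite α] (hab : a ≠ b) (h : f.SameCycle a b) :
    ¬ (f * swap a b).SameCycle a b := by
  classical
  have hex : ∃ n, 0 < n ∧ (f ^ n) b = a := by
    obtain ⟨n, h0, -, hn⟩ := h.symm.exists_pow_eq''
    exact ⟨n, h0, hn⟩
  have h1 := Nat.find_spec hex
  set N := Nat.find hex with hN
  have hb : ∀ m, 0 < m → m < N → (f ^ m) b ≠ a ∧ (f ^ m) b ≠ b := by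
    intro m h0 hm
    refine ⟨fun e => Nat.find_min hex hm ⟨h0, e⟩, fun e => ?_⟩
    -- A return to `b` at time `m` could be cut out, so that `a` would be reached already at time `N
    -- - m`.
    refine Nat.find_min hex (m := N - m) (by omega) ⟨by omega, ?_⟩
    have := h1.2
    rw [show N = N - m + m by omega, pow_add, Perm.mul_apply, e] at this
    exact this
  have hpow : ∀ m, 0 < m → m ≤ N → ((f * swap a b) ^ m) a = (f ^ m) b := fun m h0 hm =>
    mul_swap_pow_apply h0 fun k hk0 hk => hb k hk0 (hk.trans_le hm)
  have hper : ((f * swap a b) ^ N) a = a := (hpow N h1.1 le_rfl).trans h1.2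
  intro hs
  obtain ⟨n, hn⟩ := hs.exists_nat_pow_eq
  have hmod : ((f * swap a b) ^ (n % N)) a = b := by
    have hfix : (((f * swap a b) ^ N) ^ (n / N)) a = a := Function.IsFixedPt.perm_pow hper _
    refine Eq.trans ?_ hn
    conv_rhs => rw [← Nat.mod_add_div n N, pow_add, pow_mul, Perm.mul_apply, hfix]
  rcases Nat.eq_zero_or_pos (n % N) with h0 | h0
  · rw [h0] at hmod
    exact hab hmod
  · have hlt := Nat.mod_lt n h1.1
    rw [hpow _ h0 hlt.le] at hmod
    exact (hb _ h0 hlt).2 hmod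

/-- A cycle of `f` is contained in a cycle of `f * swap a b`, or in the union of the cycles of `a`
and `b`. -/
theorem SameCycle.mul_swap {x y : α} (h : f.SameCycle x y) :
    (f * swap a b).SameCycle x y ∨
      (((f * swap a b).SameCycle a x ∨ (f * swap a b).SameCycle b x) ∧
        ((f * swap a b).SameCycle a y ∨ (f * swap a b).SameCycle b y)) := by
  set g := f * swap a b with hg
  have hfa : g b = f a := by simp [hg]
  have hfb : g a = f b := by simp [hg]
  have hf : ∀ z, z ≠ a → z ≠ b → g z = f z := fun z ha hb => by
    simp [hg, swap_apply_of_ne_of_ne ha hb]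
  obtain ⟨n, rfl⟩ := h
  -- The claim is invariant under `z ↦ f z` in both directions, which permits induction over integer
  -- powers. Only `z = a` and `z = b` matter, where `f` and `g` have their values interchanged.
  have key : ∀ z, (g.SameCycle x z ∨ ((g.SameCycle a x ∨ g.SameCycle b x) ∧
      (g.SameCycle a z ∨ g.SameCycle b z))) ↔ (g.SameCycle x (f z) ∨
      ((g.SameCycle a x ∨ g.SameCycle b x) ∧ (g.SameCycle a (f z) ∨ g.SameCycle b (f z)))) := by
    intro z
    by_cases ha : z = a
    · subst ha
      rw [← hfa]
      simp only [sameCycle_apply_right, SameCycle.refl, true_or, or_true, and_true]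
      rw [sameCycle_comm (x := x) (y := z), sameCycle_comm (x := x) (y := b)]
      tauto
    by_cases hb : z = b
    · subst hb
      rw [← hfb]
      simp only [sameCycle_apply_right, SameCycle.refl, true_or, or_true, and_true]
      rw [sameCycle_comm (x := x) (y := z), sameCycle_comm (x := x) (y := a)]
      tauto
    rw [← hf z ha hb]
    simp only [sameCycle_apply_right]
  induction n with
  | zero => exact Or.inl (SameCycle.refl _ _)
  | succ k ih =>
    rw [add_comm, zpow_add, zpow_one, Perm.mul_apply]
    exact (key _).1 ih
  | pred k ih =>
    refine (key _).2 ?_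
    rw [← Perm.mul_apply, ← zpow_one_add]
    convert ih using 8 <;> ring_nf

theorem sameCycle_mul_swap_iff {x y : α} (ha : ¬ f.SameCycle a x) (hb : ¬ f.SameCycle b x) :
    (f * swap a b).SameCycle x y ↔ f.SameCycle x y := by
  have hf : f * swap a b * swap a b = f := by simp [mul_assoc]
  constructor
  · intro h
    have := h.mul_swap (a := a) (b := b)
    rw [hf] at this
    tauto
  · intro h
    refine h.mul_swap.resolve_right fun h2 => ?_
    rcases h2.1 with h3 | h3
    all_goals
      have := h3.mul_swap (a := a) (b := b)
      rw [hf] at this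
      simp only [SameCycle.refl, true_or, or_true, true_and] at this
      tauto

theorem sameCycle_or_iff_of_split [Finite α] {x : α} (h : f.SameCycle a b) :
    f.SameCycle a x ↔ (f * swap a b).SameCycle a x ∨ (f * swap a b).SameCycle b x := by
  have hf : f * swap a b * swap a b = f := by simp [mul_assoc]
  constructor
  · intro hx
    have := hx.mul_swap (a := a) (b := b)
    tauto
  · have hb : f.SameCycle b x → f.SameCycle a x := h.trans
    rintro (h3 | h3)
    all_goals
      have := h3.mul_swap (a := a) (b := b)
      rw [hf] at this
      tauto

end Equiv.Perm

/-! ### Circles as cycles of a permutation -/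

namespace TypeD

@[simp] theorem Side.opp_opp (s : Side) : s.opp.opp = s := by cases s <;> rfl

/-- The sign `1` for `∧` and `-1` for `∨`. -/
def Label.sign : Label → ℤ
  | .wedge => 1
  | .vee => -1

theorem Label.sign_mul_self (l : Label) : l.sign * l.sign = 1 := by cases l <;> rfl

theorem Label.sign_eq_neg_of_ne {l l' : Label} (h : l ≠ l') : l.sign = -l'.sign := by
  cases l <;> cases l' <;> simp_all [Label.sign]

namespace Diagram

variable {V : Type}

/-- The strands fit together, and each arc joins vertices whose numbers have different parities. -/
structure Alternating (D : Diagram V) : Prop where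
  vertical : ∀ s v, D.kind s v = .vertical →
    D.nbr s.opp (D.nbr s v) = v ∧ D.num (D.nbr s v) = D.num v
  arc : ∀ s v, D.kind s v ≠ .vertical →
    D.nbr s (D.nbr s v) = v ∧ Odd (D.num (D.nbr s v) + D.num v)

/-- The side on which the curves that turn counterclockwise around their interior leave `v`. -/
def dir (D : Diagram V) (v : V) : Side := if Even (D.num v) then .above else .below

theorem dir_eq_of_num_eq {D : Diagram V} {v w : V} (h : D.num v = D.num w) : D.dir v = D.dir w := by
  rw [dir, h, dir]

theorem dir_eq_opp_of_odd {D : Diagram V} {v w : V} (h : Odd (D.num v + D.num w)) :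
    D.dir v = (D.dir w).opp := by
  unfold dir
  rw [Nat.odd_add, ← Nat.not_even_iff_odd] at h
  split_ifs <;> first | rfl | tauto

namespace Alternating

variable {D : Diagram V} (hD : D.Alternating)
include hD

theorem dir_nbr (s : Side) (v : V) :
    D.dir (D.nbr s v) = if D.kind s v = .vertical then D.dir v else (D.dir v).opp := by
  split_ifs with h
  · exact dir_eq_of_num_eq (hD.vertical s v h).2
  · exact dir_eq_opp_of_odd (hD.arc s v h).2

/-- An arc comes back to the side it left from but changes the parity, hence `dir`; a vertical
segment arrives on the other side and keeps `dir`. In both cases the way back leaves opposite to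
`dir`. -/
theorem nbr_nbr_dir (v : V) : D.nbr (D.dir (D.nbr (D.dir v) v)).opp (D.nbr (D.dir v) v) = v := by
  rw [hD.dir_nbr]
  split_ifs with h
  · exact (hD.vertical _ v h).1
  · rw [Side.opp_opp]
    exact (hD.arc _ v h).1

theorem nbr_nbr_dir_opp (v : V) :
    D.nbr (D.dir (D.nbr (D.dir v).opp v)) (D.nbr (D.dir v).opp v) = v := by
  rw [hD.dir_nbr]
  split_ifs with h
  · have := (hD.vertical _ v h).1
    rwa [Side.opp_opp] at this
  · exact (hD.arc _ v h).1

/-- The permutation of the vertices given by moving one step along each circle. -/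
def perm : Equiv.Perm V where
  toFun v := D.nbr (D.dir v) v
  invFun v := D.nbr (D.dir v).opp v
  left_inv := hD.nbr_nbr_dir
  right_inv := hD.nbr_nbr_dir_opp

theorem perm_apply (v : V) : hD.perm v = D.nbr (D.dir v) v := rfl

theorem perm_symm_apply (v : V) : hD.perm⁻¹ v = D.nbr (D.dir v).opp v := rfl

theorem sameCycle_nbr (s : Side) (v : V) : hD.perm.SameCycle v (D.nbr s v) := by
  by_cases h : s = D.dir v
  · rw [h, ← hD.perm_apply, Equiv.Perm.sameCycle_apply_right]
  · have : s = (D.dir v).opp := by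
      revert h
      generalize D.dir v = t
      cases s <;> cases t <;> simp [Side.opp]
    rw [this, ← hD.perm_symm_apply]
    exact ⟨-1, rfl⟩

/-- A walk that leaves a vertex along `dir` does so at all later vertices, so it iterates `perm`; a
walk started against `dir` iterates the inverse. -/
theorem next_dir (v : V) : D.next (v, D.dir v) = (hD.perm v, D.dir (hD.perm v)) := by
  rw [next, hD.perm_apply, hD.dir_nbr]

theorem next_dir_opp (v : V) :
    D.next (v, (D.dir v).opp) = (hD.perm⁻¹ v, (D.dir (hD.perm⁻¹ v)).opp) := by
  rw [next, hD.perm_symm_apply, hD.dir_nbr]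
  split_ifs <;> simp

theorem next_iterate_dir (n : ℕ) (v : V) :
    D.next^[n] (v, D.dir v) = ((hD.perm ^ n) v, D.dir ((hD.perm ^ n) v)) := by
  induction n with
  | zero => rfl
  | succ n ih => rw [Function.iterate_succ_apply', ih, hD.next_dir, pow_succ', Equiv.Perm.mul_apply]

theorem next_iterate_dir_opp (n : ℕ) (v : V) : D.next^[n] (v, (D.dir v).opp) =
    (((hD.perm⁻¹) ^ n) v, (D.dir (((hD.perm⁻¹) ^ n) v)).opp) := by
  induction n with
  | zero => rfl
  | succ n ih =>
    rw [Function.iterate_succ_apply', ih, hD.next_dir_opp, pow_succ', Equiv.Perm.mul_apply]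

variable [Fintype V] [LinearOrder V]

/-- This justifies the bounded walks in `circle` and `length`: in either direction, fewer steps than
there are vertices exhaust the cycle. -/
theorem exists_next_iterate_iff (s : Side) (v w : V) :
    (∃ n < Fintype.card V, (D.next^[n] (v, s)).1 = w) ↔ hD.perm.SameCycle v w := by
  rcases (show s = D.dir v ∨ s = (D.dir v).opp by
    generalize D.dir v = t
    cases s <;> cases t <;> simp [Side.opp]) with rfl | rfl
  · simp only [hD.next_iterate_dir]
    exact ⟨fun ⟨n, _, h⟩ => ⟨n, by rw [zpow_natCast, h]⟩, fun h => h.exists_pow_lt_card⟩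
  · simp only [hD.next_iterate_dir_opp]
    rw [← Equiv.Perm.sameCycle_inv]
    exact ⟨fun ⟨n, _, h⟩ => ⟨n, by rw [zpow_natCast, h]⟩, fun h => h.exists_pow_lt_card⟩

theorem mem_circle {v w : V} : w ∈ D.circle v ↔ hD.perm.SameCycle v w := by
  rw [← hD.exists_next_iterate_iff .below]
  simp [circle]

theorem mem_circle_comm {v w : V} : w ∈ D.circle v ↔ v ∈ D.circle w := by
  rw [hD.mem_circle, hD.mem_circle, Equiv.Perm.sameCycle_comm]

theorem circle_eq {v w : V} (h : w ∈ D.circle v) : D.circle w = D.circle v := by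
  rw [hD.mem_circle] at h
  ext x
  rw [hD.mem_circle, hD.mem_circle]
  exact ⟨h.trans, h.symm.trans⟩

theorem mem_circle_trans {u v w : V} (h : v ∈ D.circle u) (h' : w ∈ D.circle v) :
    w ∈ D.circle u := hD.circle_eq h ▸ h'

theorem base_eq {v w : V} (h : w ∈ D.circle v) : D.base w = D.base v := by
  simp only [base, hD.circle_eq h]

theorem nbr_mem_circle (s : Side) (v : V) : D.nbr s v ∈ D.circle v :=
  hD.mem_circle.2 (hD.sameCycle_nbr s v)

theorem nbr_mem_circle_iff (s : Side) {v w : V} : D.nbr s v ∈ D.circle w ↔ v ∈ D.circle w :=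
  ⟨fun h => hD.mem_circle_trans h (hD.mem_circle_comm.1 (hD.nbr_mem_circle s v)),
    fun h => hD.mem_circle_trans h (hD.nbr_mem_circle s v)⟩

/-- A property that is preserved along the strands of a circle holds on the whole circle. -/
theorem circle_induction {v : V} {P : V → Prop} (h0 : P v)
    (h : ∀ s w, w ∈ D.circle v → P w → P (D.nbr s w)) : ∀ w ∈ D.circle v, P w := by
  intro w hw
  obtain ⟨n, rfl⟩ := (hD.mem_circle.1 hw).exists_nat_pow_eq
  clear hw
  induction n with
  | zero => exact h0
  | succ n ih =>
    rw [pow_succ', Equiv.Perm.mul_apply, hD.perm_apply]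
    exact h _ _ (hD.mem_circle.2 ⟨n, by rw [zpow_natCast]⟩) ih

end Alternating

/-! ### Parity of lengths along a path -/

section

variable [LinearOrder V] (D : Diagram V)

/-- Telescoping: `σ` is a potential whose change along each strand is the sign contributed by that
strand. -/
theorem neg_one_pow_lengthAux (k : StrandKind) (σ : V → ℤ) (y : V)
    (h : ∀ s v, (-1) ^ (if D.kind s v = k then Nat.dist (D.num v) (D.num (D.nbr s v)) else 0)
      * σ (D.nbr s v) = σ v) (n : ℕ) (p : V × Side) (hp : ∃ m ≤ n, (D.next^[m] p).1 = y) :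
    (-1) ^ D.lengthAux k y n p * σ y = σ p.1 := by
  induction n generalizing p with
  | zero =>
    obtain ⟨m, hm, rfl⟩ := hp
    obtain rfl : m = 0 := by omega
    simp [lengthAux]
  | succ n ih =>
    rw [lengthAux]
    split_ifs with hy hk
    · simp [hy]
    all_goals
      obtain ⟨m, hm, h'⟩ := hp
      rcases m with _ | m
      · exact absurd h' hy
      have := ih (D.next p) ⟨m, by omega, h'⟩
      rw [pow_add, mul_assoc, this, ← h p.2 p.1]
      simp [hk, next]

/-- Every arc is counted in exactly one of the two lengths and has the parity of the difference of
its ends, while vertical segments keep the number. Thus the sum telescopes. -/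
theorem neg_one_pow_lengthAux_mul (y : V)
    (hD : D.Alternating) (n : ℕ) (p : V × Side) (hp : ∃ m ≤ n, (D.next^[m] p).1 = y) :
    (-1 : ℤ) ^ D.lengthAux .unmarked y n p * (-1) ^ D.lengthAux .marked y n p * (-1) ^ D.num y =
      (-1) ^ D.num p.1 := by
  induction n generalizing p with
  | zero =>
    obtain ⟨m, hm, rfl⟩ := hp
    obtain rfl : m = 0 := by omega
    simp [lengthAux]
  | succ n ih =>
    rw [lengthAux, lengthAux]
    by_cases hy : p.1 = y
    · simp [hy]
    obtain ⟨m, hm, h'⟩ := hp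
    rcases m with _ | m
    · exact absurd h' hy
    have := ih (D.next p) ⟨m, by omega, h'⟩
    simp only [hy, if_false]
    have hd : D.kind p.2 p.1 ≠ .vertical → (-1 : ℤ) ^ Nat.dist (D.num p.1) (D.num (D.nbr p.2 p.1)) *
        (-1) ^ (D.num (D.nbr p.2 p.1)) = (-1) ^ D.num p.1 := by
      intro hk
      have ho := (hD.arc p.2 p.1 hk).2
      rw [← pow_add]
      refine neg_one_pow_congr ?_
      rw [Nat.dist]
      grind
    rcases hk : D.kind p.2 p.1
    · rw [← hd (by simp [hk])]
      simp only [next, hk, if_true, reduceCtorEq, if_false, zero_add, pow_add] at this ⊢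
      rw [← this]
      ring
    · rw [← hd (by simp [hk])]
      simp only [next, hk, if_true, reduceCtorEq, if_false, zero_add, pow_add] at this ⊢
      rw [← this]
      ring
    · simp only [reduceCtorEq, if_false, zero_add]
      rw [this, next, (hD.vertical p.2 p.1 hk).2]

end

variable [Fintype V] [LinearOrder V] (D : Diagram V)

theorem base_mem_circle (v : V) : D.base v ∈ D.circle v := Finset.max'_mem _ _

theorem le_base {v w : V} (h : w ∈ D.circle v) : w ≤ D.base v := Finset.le_max' _ _ h

section

variable {D} (hD : D.Alternating)
include hD

/-- The bridge between the two algebras: it converts unmarked signs into marked ones at the cost of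
the parities of the endpoints. -/
theorem Alternating.unmarkedSign_mul_markedSign {x y : V} (h : y ∈ D.circle x) :
    D.unmarkedSign x y * D.markedSign x y * (-1) ^ D.num y = (-1) ^ D.num x := by
  obtain ⟨n, hn, hy⟩ := (hD.exists_next_iterate_iff .below x y).2 (hD.mem_circle.1 h)
  exact D.neg_one_pow_lengthAux_mul y hD _ _ ⟨n, hn.le, hy⟩

/-- Labels change exactly along unmarked arcs, and these have odd length. So the label sign is a
potential for the unmarked length. -/
theorem Alternating.unmarkedSign_eq {o : V → Label} (ho : D.IsOrientation o) {x y : V}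
    (h : y ∈ D.circle x) : D.unmarkedSign x y * (o y).sign = (o x).sign := by
  obtain ⟨n, hn, hy⟩ := (hD.exists_next_iterate_iff .below x y).2 (hD.mem_circle.1 h)
  refine D.neg_one_pow_lengthAux .unmarked (fun v => (o v).sign) y ?_ _ _ ⟨n, hn.le, hy⟩
  intro s v
  have h1 := ho s v
  split_ifs at h1 ⊢ with hk
  · have := (hD.arc s v (by simp [hk])).2
    rw [Label.sign_eq_neg_of_ne h1, Odd.neg_one_pow]
    · simp
    · rw [Nat.dist]
      grind
  · simp [h1]

/-- The contribution of a vertex, if it is the base point of its circle. -/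
theorem Alternating.coeff_eq (o : V → Label) : D.coeff o =
    ∏ v, if D.base v = v ∧ o v = .vee then -(-1) ^ D.num v else 1 := by
  -- Each circle contains exactly one vertex that is its own base point, which turns the product
  -- over circles into one over vertices.
  have h1 : D.circles = (Finset.univ.filter fun v => D.base v = v).image D.circle := by
    ext C
    simp only [circles, Finset.mem_image, Finset.mem_univ, true_and, Finset.mem_filter]
    constructor
    · rintro ⟨v, rfl⟩
      exact ⟨D.base v, hD.base_eq (D.base_mem_circle v), hD.circle_eq (D.base_mem_circle v)⟩
    · rintro ⟨v, -, rfl⟩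
      exact ⟨v, rfl⟩
  rw [coeff, h1, Finset.prod_image]
  · rw [Finset.prod_filter]
    refine Finset.prod_congr rfl fun v _ => ?_
    by_cases hv : D.base v = v
    · have hne : (D.circle v).Nonempty := ⟨v, D.self_mem_circle v⟩
      have : (D.circle v).max' hne = v := hv
      simp [hv, circleCoeff, hne, this]
    · simp [hv]
  · intro v hv w hw hvw
    simp only [Finset.coe_filter, Finset.mem_univ, true_and, Set.mem_ofPred_eq] at hv hw
    rw [← hv, ← hw]
    simp only [base, hvw]

end

/-- The contribution of the circle through `v` to the rescaling. -/
def coeffAt (o : V → Label) (v : V) : ℤ :=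
  if o (D.base v) = .vee then -(-1) ^ D.num (D.base v) else 1

theorem Alternating.prod_circle {D : Diagram V} (hD : D.Alternating) (o : V → Label) (x : V) :
    (∏ v ∈ D.circle x, if D.base v = v ∧ o v = .vee then -(-1 : ℤ) ^ D.num v else 1) =
      D.coeffAt o x := by
  rw [Finset.prod_eq_single (D.base x)]
  · rw [coeffAt, hD.base_eq (D.base_mem_circle x)]
    simp
  · intro v hv hne
    rw [if_neg]
    rintro ⟨h, -⟩
    exact hne (h ▸ hD.base_eq hv)
  · exact fun h => absurd (D.base_mem_circle x) h

end Diagram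

end TypeD

/-! ### Parity arguments in a cup diagram -/

namespace TypeD

namespace CupDiagram

variable {K : ℕ} (c : CupDiagram K)

/-- The arcs give a fixed-point-free involution of `s`, so the factors `-1` cancel in pairs. -/
theorem even_card_of_closed (s : Finset (Fin (2 * K))) (h : ∀ i ∈ s, c.partner i ∈ s) :
    Even s.card := by
  have h1 : ∏ _i ∈ s, (-1 : ℤ) = 1 :=
    Finset.prod_involution (fun i _ => c.partner i) (fun _ _ => by norm_num)
      (fun i _ _ => c.partner_ne i) (fun i hi => h i hi) (fun i _ => c.partner_partner i)
  rw [Finset.prod_const] at h1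
  exact (neg_one_pow_eq_one_iff_even (by norm_num)).1 h1

/-- The points of a set strictly between the ends of an arc come in pairs, if the partners of such
points are in the set again. -/
theorem even_card_between (T : Finset (Fin (2 * K))) (v : Fin (2 * K))
    (hT : ∀ k ∈ T, v < k → k < c.partner v → c.partner k ∈ T) :
    Even (T.filter fun k => v < k ∧ k < c.partner v).card := by
  refine c.even_card_of_closed _ fun i hi => ?_
  simp only [Finset.mem_filter] at hi ⊢
  exact ⟨hT i hi.1 hi.2.1 hi.2.2, c.noncrossing v i hi.2.1 hi.2.2⟩

/-- The two counts differ by the points of `T` strictly between the ends of the arc, and these come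
in pairs. -/
theorem card_filter_lt_aux (T : Finset (Fin (2 * K))) (v : Fin (2 * K)) (hv : v ∉ T)
    (hlt : v < c.partner v)
    (hT : ∀ k ∈ T, v < k → k < c.partner v → c.partner k ∈ T) :
    Odd (T.filter fun k => k < v).card ↔ Odd (T.filter fun k => k < c.partner v).card := by
  have h1 : (T.filter fun k => k < c.partner v) =
      (T.filter fun k => k < v) ∪ (T.filter fun k => v < k ∧ k < c.partner v) := by
    ext k
    simp only [Finset.mem_filter, Finset.mem_union]
    constructor
    · rintro ⟨hk, h⟩
      rcases lt_trichotomy k v with h' | rfl | h'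
      · exact Or.inl ⟨hk, h'⟩
      · exact absurd hk hv
      · exact Or.inr ⟨hk, h', h⟩
    · rintro (⟨hk, h⟩ | ⟨hk, h, h'⟩)
      · exact ⟨hk, h.trans hlt⟩
      · exact ⟨hk, h'⟩
  rw [h1, Finset.card_union_of_disjoint]
  · have := c.even_card_between T v hT
    rw [Nat.odd_add]
    tauto
  · rw [Finset.disjoint_filter]
    rintro k - h ⟨h', -⟩
    exact lt_asymm h h'

/-- Moving along an arc does not change the parity of the number of points of a set `T` to the
left, if below the arc `T` consists of pairs of partners. -/
theorem odd_card_filter_lt_partner (T : Finset (Fin (2 * K))) (v : Fin (2 * K)) (hv : v ∉ T)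
    (hv' : c.partner v ∉ T)
    (hT : ∀ k ∈ T, (v < k ∧ k < c.partner v) ∨ (c.partner v < k ∧ k < v) → c.partner k ∈ T) :
    Odd (T.filter fun k => k < v).card ↔ Odd (T.filter fun k => k < c.partner v).card := by
  rcases lt_or_gt_of_ne (c.partner_ne v) with h | h
  · have := c.card_filter_lt_aux T (c.partner v) hv' (by rwa [c.partner_partner])
      fun k hk h1 h2 => hT k hk (Or.inr ⟨h1, by rwa [c.partner_partner] at h2⟩)
    rw [c.partner_partner] at this
    exact this.symm
  · exact c.card_filter_lt_aux T v hv h fun k hk h1 h2 => hT k hk (Or.inl ⟨h1, h2⟩)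

/-- The vertices strictly between the ends of an arc are matched among themselves, so there is an
even number of them. -/
theorem odd_vertexNumber_add (v : Fin (2 * K)) :
    Odd (vertexNumber (c.partner v) + vertexNumber v) := by
  wlog hlt : v < c.partner v generalizing v
  · have := this (c.partner v) (by
      rw [c.partner_partner]
      exact lt_of_le_of_ne (not_lt.1 hlt) (c.partner_ne v))
    rwa [c.partner_partner, add_comm] at this
  have h := c.even_card_between Finset.univ v fun _ _ _ _ => Finset.mem_univ _
  have h1 : (Finset.univ.filter fun k => v < k ∧ k < c.partner v) = Finset.Ioo v (c.partner v) := by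
    ext k; simp
  rw [h1, Fin.card_Ioo] at h
  have : v.val < (c.partner v).val := hlt
  simp only [vertexNumber]
  grind

theorem kind_ne_vertical (v : Fin (2 * K)) : c.kind v ≠ .vertical := by
  rw [kind]; split_ifs <;> simp

end CupDiagram

theorem circleDiagram_alternating {K : ℕ} (c d : CupDiagram K) :
    (circleDiagram c d).Alternating where
  vertical := by
    rintro (_ | _) v h
    · exact absurd h (c.kind_ne_vertical v)
    · exact absurd h (d.kind_ne_vertical v)
  arc := by
    rintro (_ | _) v -
    · exact ⟨c.partner_partner v, c.odd_vertexNumber_add v⟩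
    · exact ⟨d.partner_partner v, d.odd_vertexNumber_add v⟩

section

variable {K : ℕ}

@[simp] theorem lo_injective {i j : Fin (2 * K)} : lo i = lo j ↔ i = j := by
  simp [lo]

@[simp] theorem up_injective {i j : Fin (2 * K)} : up i = up j ↔ i = j := by
  simp [up]

@[simp] theorem lo_ne_up (i j : Fin (2 * K)) : lo i ≠ up j := by
  simp [lo, up]

@[simp] theorem up_ne_lo (i j : Fin (2 * K)) : up i ≠ lo j := by
  simp [lo, up]

@[simp] theorem glue_lo {α : Type} (f g : Fin (2 * K) → α) (i : Fin (2 * K)) :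
    glue f g (lo i) = f i := rfl

@[simp] theorem glue_up {α : Type} (f g : Fin (2 * K) → α) (i : Fin (2 * K)) :
    glue f g (up i) = g i := rfl

theorem StackedVertex.exists_eq (v : StackedVertex K) : (∃ i, v = lo i) ∨ ∃ i, v = up i := by
  obtain ⟨i, b⟩ := v
  cases b
  · exact Or.inl ⟨i, rfl⟩
  · exact Or.inr ⟨i, rfl⟩

theorem lo_lt_lo {i j : Fin (2 * K)} : lo i < lo j ↔ i < j := by
  simp [lo, Prod.Lex.toLex_lt_toLex]

theorem up_lt_up {i j : Fin (2 * K)} : up i < up j ↔ i < j := by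
  simp [up, Prod.Lex.toLex_lt_toLex]

end

/-! ### Stacked diagrams reachable by surgeries -/

namespace Stacked

variable {K : ℕ}

/-- The surgered pairs of the middle section are removed from outside to inside, and the marked
pairs are removed from right to left. -/
structure Valid (S : Stacked K) : Prop where
  partner_mem : ∀ i, i ∈ S.cut → S.mid.partner i ∈ S.cut
  outer_mem : ∀ i k, i ∈ S.cut → k < i → i < S.mid.partner k → k ∈ S.cut
  not_lt_marked : ∀ k m, m ∉ S.cut → S.mid.marked m = true → k < m → k ∉ S.cut

section

variable (S : Stacked K) (i : Fin (2 * K))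

@[simp] theorem num_lo : S.diagram.num (lo i) = vertexNumber i := rfl
@[simp] theorem num_up : S.diagram.num (up i) = vertexNumber i := rfl
@[simp] theorem nbr_below_lo : S.diagram.nbr .below (lo i) = lo (S.bot.partner i) := rfl
@[simp] theorem nbr_above_up : S.diagram.nbr .above (up i) = up (S.top.partner i) := rfl
@[simp] theorem nbr_below_up :
    S.diagram.nbr .below (up i) = if i ∈ S.cut then lo i else up (S.mid.partner i) := rfl
@[simp] theorem nbr_above_lo :
    S.diagram.nbr .above (lo i) = if i ∈ S.cut then up i else lo (S.mid.partner i) := rfl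
@[simp] theorem kind_below_lo : S.diagram.kind .below (lo i) = S.bot.kind i := rfl
@[simp] theorem kind_above_up : S.diagram.kind .above (up i) = S.top.kind i := rfl
@[simp] theorem kind_below_up :
    S.diagram.kind .below (up i) = if i ∈ S.cut then .vertical else S.mid.kind i := rfl
@[simp] theorem kind_above_lo :
    S.diagram.kind .above (lo i) = if i ∈ S.cut then .vertical else S.mid.kind i := rfl

end

theorem Valid.partner_mem_iff {S : Stacked K} (hS : S.Valid) (i : Fin (2 * K)) :
    S.mid.partner i ∈ S.cut ↔ i ∈ S.cut :=
  ⟨fun h => by simpa [S.mid.partner_partner] using hS.partner_mem _ h, hS.partner_mem i⟩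

theorem Valid.alternating {S : Stacked K} (hS : S.Valid) : S.diagram.Alternating where
  vertical := by
    rintro (_ | _) v h
    all_goals rcases v.exists_eq with ⟨i, rfl⟩ | ⟨i, rfl⟩
    · exact absurd h (S.bot.kind_ne_vertical i)
    · by_cases hi : i ∈ S.cut
      · simp [hi, Side.opp]
      · exact absurd h (by simp [hi, S.mid.kind_ne_vertical i])
    · by_cases hi : i ∈ S.cut
      · simp [hi, Side.opp]
      · exact absurd h (by simp [hi, S.mid.kind_ne_vertical i])
    · exact absurd h (S.top.kind_ne_vertical i)
  arc := by
    rintro (_ | _) v h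
    all_goals rcases v.exists_eq with ⟨i, rfl⟩ | ⟨i, rfl⟩
    · exact ⟨by simp [S.bot.partner_partner], S.bot.odd_vertexNumber_add i⟩
    · by_cases hi : i ∈ S.cut
      · exact absurd (by simp [hi]) h
      · simp [hi, hS.partner_mem_iff, S.mid.partner_partner, S.mid.odd_vertexNumber_add i]
    · by_cases hi : i ∈ S.cut
      · exact absurd (by simp [hi]) h
      · simp [hi, hS.partner_mem_iff, S.mid.partner_partner, S.mid.odd_vertexNumber_add i]
    · exact ⟨by simp [S.top.partner_partner], S.top.odd_vertexNumber_add i⟩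

theorem mem_surgery_cut {S : Stacked K} {i k : Fin (2 * K)} :
    k ∈ (S.surgery i).cut ↔ k ∈ S.cut ∨ k = i ∨ k = S.mid.partner i := by
  simp only [surgery, Finset.mem_union, Finset.mem_insert, Finset.mem_singleton]

theorem Valid.surgery {S : Stacked K} (hS : S.Valid) {i : Fin (2 * K)} (hi : S.Available i) :
    (S.surgery i).Valid where
  partner_mem k hk := by
    change S.mid.partner k ∈ _
    rw [mem_surgery_cut] at hk ⊢
    rcases hk with hk | rfl | rfl
    · exact Or.inl (hS.partner_mem k hk)
    · exact Or.inr (Or.inr rfl)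
    · exact Or.inr (Or.inl (S.mid.partner_partner i))
  outer_mem k l hk h1 h2 := by
    change k < S.mid.partner l at h2
    rw [mem_surgery_cut] at hk ⊢
    rcases hk with hk | rfl | rfl
    · exact Or.inl (hS.outer_mem k l hk h1 h2)
    · by_contra hl
      exact hi.2.2.1 l (fun h => hl (Or.inl h)) ⟨h1, h2⟩
    · by_contra hl
      push Not at hl
      rcases lt_trichotomy l i with h | h | h
      · exact hi.2.2.1 l hl.1 ⟨h, hi.2.1.trans h2⟩
      · exact hl.2.1 h
      · exact lt_asymm h2 (S.mid.noncrossing i l h h1).2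
  not_lt_marked k m hm hmm hkm hk := by
    change S.mid.marked m = true at hmm
    rw [mem_surgery_cut] at hm hk
    push Not at hm
    -- A remaining marked vertex to the right of `i` would lie either between the ends of the arc at
    -- `i`, against admissibility, or beyond its right end, against availability.
    have key : ¬ i < m := by
      intro him
      rcases lt_or_gt_of_ne hm.2.2 with h | h
      · exact S.mid.admissible m i hmm ⟨him, h⟩
      · simp [hi.2.2.2 m hm.1 h] at hmm
    rcases hk with hk | rfl | rfl
    · exact hS.not_lt_marked k m hm.1 hmm hkm hk
    · exact key hkm
    · exact key (hi.2.1.trans hkm)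

/-- If marked arcs remain, the one with the rightmost left end works: admissibility forbids any arc
around it, and a marked vertex further right would force such an arc or contradict maximality. If
none remains, the leftmost remaining vertex works. -/
theorem exists_available {S : Stacked K} (hS : S.Valid) (h : S.cut ≠ Finset.univ) :
    ∃ i, S.Available i := by
  obtain ⟨u, hu⟩ : ∃ u, u ∉ S.cut := by
    by_contra! h'
    exact h (Finset.eq_univ_iff_forall.2 h')
  by_cases hm : ∃ m, m ∉ S.cut ∧ S.mid.marked m = true
  · let T := Finset.univ.filter fun m => m ∉ S.cut ∧ S.mid.marked m = true ∧ m < S.mid.partner m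
    have hT : T.Nonempty := by
      obtain ⟨m, hm1, hm2⟩ := hm
      rcases lt_or_gt_of_ne (S.mid.partner_ne m) with h | h
      · exact ⟨S.mid.partner m, by simp [T, hS.partner_mem_iff, hm1, S.mid.marked_partner, hm2,
          S.mid.partner_partner, h]⟩
      · exact ⟨m, by simp [T, hm1, hm2, h]⟩
    obtain ⟨i, hmem, hmax⟩ : ∃ i ∈ T, ∀ x ∈ T, x ≤ i :=
      ⟨T.max' hT, T.max'_mem hT, fun x hx => T.le_max' x hx⟩
    simp only [T, Finset.mem_filter, Finset.mem_univ, true_and] at hmem hmax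
    refine ⟨i, hmem.1, hmem.2.2, fun k _ hk => S.mid.admissible i k hmem.2.1 hk,
      fun k hk hik => ?_⟩
    by_contra hmk
    rw [Bool.not_eq_false] at hmk
    rcases lt_or_gt_of_ne (S.mid.partner_ne k) with h | h
    · have h1 := hmax (S.mid.partner k) ⟨by rwa [hS.partner_mem_iff],
        by rwa [S.mid.marked_partner], by rwa [S.mid.partner_partner]⟩
      rcases h1.lt_or_eq with h1 | h1
      · refine S.mid.admissible i (S.mid.partner k) hmem.2.1 ⟨h1, ?_⟩
        rw [S.mid.partner_partner]
        exact hmem.2.2.trans hik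
      · rw [← h1, S.mid.partner_partner] at hik
        exact lt_irrefl _ hik
    · exact absurd (hmax k ⟨hk, hmk, h⟩) (not_le.2 (hmem.2.2.trans hik))
  · push Not at hm
    let T := Finset.univ.filter fun m => m ∉ S.cut
    have hT : T.Nonempty := ⟨u, by simp [T, hu]⟩
    obtain ⟨i, hmem, hmin⟩ : ∃ i ∈ T, ∀ x ∈ T, i ≤ x :=
      ⟨T.min' hT, T.min'_mem hT, fun x hx => T.min'_le x hx⟩
    simp only [T, Finset.mem_filter, Finset.mem_univ, true_and] at hmem hmin
    refine ⟨i, hmem, lt_of_le_of_ne (hmin _ (by rwa [hS.partner_mem_iff])) (S.mid.partner_ne i).symm,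
      fun k hk h => absurd (hmin k hk) (not_le.2 h.1), fun k hk _ => by simpa using hm k hk⟩

theorem leftmost_available {S : Stacked K} {i : Fin (2 * K)} (h : S.leftmost = some i) :
    S.Available i := by
  simpa using List.find?_some h

theorem cut_eq_univ_of_leftmost {S : Stacked K} (hS : S.Valid) (h : S.leftmost = none) :
    S.cut = Finset.univ := by
  by_contra hc
  obtain ⟨i, hi⟩ := exists_available hS hc
  rw [leftmost, List.find?_eq_none] at h
  exact h i (List.mem_finRange i) (by simpa using hi)

theorem card_surgery_cut {S : Stacked K} (hS : S.Valid) {i : Fin (2 * K)} (hi : S.Available i) :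
    (S.surgery i).cut.card = S.cut.card + 2 := by
  rw [surgery, Finset.card_union_of_disjoint, Finset.card_pair (S.mid.partner_ne i).symm]
  rw [Finset.disjoint_right]
  intro k hk
  simp only [Finset.mem_insert, Finset.mem_singleton] at hk
  rcases hk with rfl | rfl
  · exact hi.1
  · rw [hS.partner_mem_iff]
    exact hi.1

/-! ### Circles before and after a surgery -/

section Surgery

variable {S : Stacked K} (hS : S.Valid) {i : Fin (2 * K)} (hi : S.Available i)
include hS hi

/-- Only the cap and the cup at `i` change. As their ends have opposite parities, `perm` runs along
the cap from one of its ends only, and along the cup from the end with the other number. The surgery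
interchanges the images of these two vertices; which two they are depends on the parity of `i`. -/
theorem exists_perm_surgery_eq : ∃ a b : StackedVertex K,
    ((hS.surgery hi).alternating.perm = hS.alternating.perm * Equiv.swap a b) ∧
    ((a = lo (S.mid.partner i) ∧ b = up i) ∨ (a = lo i ∧ b = up (S.mid.partner i))) := by
  have hj : S.mid.partner i ∉ S.cut := by rw [hS.partner_mem_iff]; exact hi.1
  have hodd := S.mid.odd_vertexNumber_add i
  have hne := S.mid.partner_ne i
  have hdir : ∀ v, (S.surgery i).diagram.dir v = S.diagram.dir v := fun v => rfl
  have hcut : ∀ k, k ∈ (S.surgery i).cut ↔ _ := fun k => mem_surgery_cut (S := S) (i := i)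
  have hbot : (S.surgery i).bot = S.bot := rfl
  have hmid : (S.surgery i).mid = S.mid := rfl
  have htop : (S.surgery i).top = S.top := rfl
  rcases hs : S.diagram.dir (lo i) with _ | _
  · have hev : ¬ Even (vertexNumber i) := by
      intro h; simp [Diagram.dir, h] at hs
    have hev' : Even (vertexNumber (S.mid.partner i)) := by grind
    refine ⟨lo (S.mid.partner i), up i, ?_, Or.inl ⟨rfl, rfl⟩⟩
    ext1 v
    rw [Equiv.Perm.mul_apply, Diagram.Alternating.perm_apply, Diagram.Alternating.perm_apply, hdir]
    by_cases h1 : v = lo (S.mid.partner i)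
    · subst h1
      simp [Diagram.dir, hev', hev, hcut, hi.1]
    by_cases h2 : v = up i
    · subst h2
      simp [Diagram.dir, hev', hev, hcut, hj, S.mid.partner_partner]
    rw [Equiv.swap_apply_of_ne_of_ne h1 h2]
    rcases v.exists_eq with ⟨k, rfl⟩ | ⟨k, rfl⟩
    all_goals
      by_cases hk : Even (vertexNumber k)
      all_goals simp [Diagram.dir, hk, hbot, htop, hmid]
      have h3 : k ≠ i := by rintro rfl; simp_all
      have h4 : k ≠ S.mid.partner i := by rintro rfl; simp_all
      simp [hcut, h3, h4]
  · have hev : Even (vertexNumber i) := by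
      by_contra h; simp [Diagram.dir, h] at hs
    have hev' : ¬ Even (vertexNumber (S.mid.partner i)) := by grind
    refine ⟨lo i, up (S.mid.partner i), ?_, Or.inr ⟨rfl, rfl⟩⟩
    ext1 v
    rw [Equiv.Perm.mul_apply, Diagram.Alternating.perm_apply, Diagram.Alternating.perm_apply, hdir]
    by_cases h1 : v = lo i
    · subst h1
      simp [Diagram.dir, hev', hev, hcut, hj, S.mid.partner_partner]
    by_cases h2 : v = up (S.mid.partner i)
    · subst h2
      simp [Diagram.dir, hev', hev, hcut, hi.1]
    rw [Equiv.swap_apply_of_ne_of_ne h1 h2]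
    rcases v.exists_eq with ⟨k, rfl⟩ | ⟨k, rfl⟩
    all_goals
      by_cases hk : Even (vertexNumber k)
      all_goals simp [Diagram.dir, hk, hbot, htop, hmid]
      have h3 : k ≠ i := by rintro rfl; simp_all
      have h4 : k ≠ S.mid.partner i := by rintro rfl; simp_all
      simp [hcut, h3, h4]

theorem circle_lo_partner : S.diagram.circle (lo (S.mid.partner i)) = S.diagram.circle (lo i) := by
  refine hS.alternating.circle_eq ?_
  simpa [hi.1] using hS.alternating.nbr_mem_circle .above (lo i)

theorem circle_up_partner : S.diagram.circle (up (S.mid.partner i)) = S.diagram.circle (up i) := by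
  refine hS.alternating.circle_eq ?_
  simpa [hi.1] using hS.alternating.nbr_mem_circle .below (up i)

theorem surgery_circle_up {k : Fin (2 * K)} (hk : k ∈ (S.surgery i).cut) :
    (S.surgery i).diagram.circle (up k) = (S.surgery i).diagram.circle (lo k) := by
  refine (hS.surgery hi).alternating.circle_eq ?_
  simpa [hk] using (hS.surgery hi).alternating.nbr_mem_circle .above (lo k)

theorem surgery_circle_of_not_mem {x : StackedVertex K} (h1 : x ∉ S.diagram.circle (lo i))
    (h2 : x ∉ S.diagram.circle (up i)) :
    (S.surgery i).diagram.circle x = S.diagram.circle x := by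
  obtain ⟨a, b, hp, hab⟩ := exists_perm_surgery_eq hS hi
  ext y
  rw [(hS.surgery hi).alternating.mem_circle, hS.alternating.mem_circle, hp]
  apply Equiv.Perm.sameCycle_mul_swap_iff
  all_goals
    rw [← hS.alternating.mem_circle]
    rcases hab with ⟨rfl, rfl⟩ | ⟨rfl, rfl⟩
    all_goals simpa [circle_lo_partner hS hi, circle_up_partner hS hi]

/-- The transposed vertices lie on one cycle, which therefore breaks into two. The new vertical
segments allow `lo i` and `lo j`, with `j` the partner of `i`, to serve as representatives in either
parity case. -/
theorem circle_of_split (h : up i ∈ S.diagram.circle (lo i)) :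
    S.diagram.circle (lo i) = (S.surgery i).diagram.circle (lo i) ∪
      (S.surgery i).diagram.circle (lo (S.mid.partner i)) := by
  have hE := (hS.surgery hi).alternating
  obtain ⟨a, b, hp, hab⟩ := exists_perm_surgery_eq hS hi
  have hj := surgery_circle_up hS hi (k := S.mid.partner i) (by simp [mem_surgery_cut])
  have hii := surgery_circle_up hS hi (k := i) (by simp [mem_surgery_cut])
  have ha : a ∈ S.diagram.circle (lo i) := by
    rcases hab with ⟨rfl, rfl⟩ | ⟨rfl, rfl⟩
    · rw [← circle_lo_partner hS hi]; exact Diagram.self_mem_circle _ _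
    · exact Diagram.self_mem_circle _ _
  have hb : b ∈ S.diagram.circle a := by
    rw [hS.alternating.circle_eq ha]
    rcases hab with ⟨rfl, rfl⟩ | ⟨rfl, rfl⟩
    · exact h
    · rw [← hS.alternating.circle_eq h, ← circle_up_partner hS hi]
      exact Diagram.self_mem_circle _ _
  ext x
  have h2 := Equiv.Perm.sameCycle_or_iff_of_split (x := x) (hS.alternating.mem_circle.1 hb)
  rw [← hp, ← hE.mem_circle, ← hE.mem_circle, ← hS.alternating.mem_circle,
    hS.alternating.circle_eq ha] at h2
  rw [h2, Finset.mem_union]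
  rcases hab with ⟨rfl, rfl⟩ | ⟨rfl, rfl⟩
  · rw [hii, or_comm]
  · rw [hj]

theorem partner_not_mem_of_split (h : up i ∈ S.diagram.circle (lo i)) :
    lo (S.mid.partner i) ∉ (S.surgery i).diagram.circle (lo i) := by
  have hE := (hS.surgery hi).alternating
  obtain ⟨a, b, hp, hab⟩ := exists_perm_surgery_eq hS hi
  have hj := surgery_circle_up hS hi (k := S.mid.partner i) (by simp [mem_surgery_cut])
  have hii := surgery_circle_up hS hi (k := i) (by simp [mem_surgery_cut])
  have hne : a ≠ b := by rcases hab with ⟨rfl, rfl⟩ | ⟨rfl, rfl⟩ <;> simp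
  have hb : b ∈ S.diagram.circle a := by
    rcases hab with ⟨rfl, rfl⟩ | ⟨rfl, rfl⟩
    · rwa [circle_lo_partner hS hi]
    · rw [← hS.alternating.circle_eq h, ← circle_up_partner hS hi]
      exact Diagram.self_mem_circle _ _
  have h2 := Equiv.Perm.not_sameCycle_mul_swap hne (hS.alternating.mem_circle.1 hb)
  rw [← hp, ← hE.mem_circle, hE.mem_circle_comm] at h2
  rcases hab with ⟨rfl, rfl⟩ | ⟨rfl, rfl⟩
  · rwa [hii] at h2
  · rw [hj] at h2
    rwa [hE.mem_circle_comm]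

theorem disjoint_of_split (h : up i ∈ S.diagram.circle (lo i)) :
    Disjoint ((S.surgery i).diagram.circle (lo i))
      ((S.surgery i).diagram.circle (lo (S.mid.partner i))) := by
  have hE := (hS.surgery hi).alternating
  rw [Finset.disjoint_left]
  intro x h1 h2
  exact partner_not_mem_of_split hS hi h
    (hE.mem_circle_trans h1 (hE.mem_circle_comm.1 h2))

/-- A merge is a split read backwards: the same transposition leads from the new permutation back to
the old one. -/
theorem surgery_circle_of_merge (h : up i ∉ S.diagram.circle (lo i)) :
    (S.surgery i).diagram.circle (lo i) = S.diagram.circle (lo i) ∪ S.diagram.circle (up i) := by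
  have hE := (hS.surgery hi).alternating
  obtain ⟨a, b, hp, hab⟩ := exists_perm_surgery_eq hS hi
  have hj := surgery_circle_up hS hi (k := S.mid.partner i) (by simp [mem_surgery_cut])
  have hii := surgery_circle_up hS hi (k := i) (by simp [mem_surgery_cut])
  have hca : S.diagram.circle a = S.diagram.circle (lo i) := by
    rcases hab with ⟨rfl, rfl⟩ | ⟨rfl, rfl⟩
    · rw [← circle_lo_partner hS hi]
    · rfl
  have hcb : S.diagram.circle b = S.diagram.circle (up i) := by
    rcases hab with ⟨rfl, rfl⟩ | ⟨rfl, rfl⟩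
    · rfl
    · rw [← circle_up_partner hS hi]
  have hb : ¬ hS.alternating.perm.SameCycle a b := by
    rw [← hS.alternating.mem_circle, hca, hS.alternating.mem_circle_comm, hcb,
      hS.alternating.mem_circle_comm]
    exact h
  have h1 := Equiv.Perm.sameCycle_mul_swap_of_not hb
  have hff : (hS.surgery hi).alternating.perm * Equiv.swap a b = hS.alternating.perm := by
    rw [hp, mul_assoc, Equiv.swap_mul_self, mul_one]
  rw [← hp] at h1
  have hEa : (S.surgery i).diagram.circle a = (S.surgery i).diagram.circle (lo i) := by
    rcases hab with ⟨rfl, rfl⟩ | ⟨rfl, rfl⟩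
    · rw [← hii]
      exact (hE.circle_eq (hE.mem_circle.2 h1)).symm
    · rfl
  ext x
  have h2 := Equiv.Perm.sameCycle_or_iff_of_split (x := x) h1
  rw [hff, ← hE.mem_circle, ← hS.alternating.mem_circle, ← hS.alternating.mem_circle, hca, hcb,
    hEa] at h2
  rw [h2, Finset.mem_union]

end Surgery

end Stacked

end TypeD

/-! ### Comparing the two signs, and nesting of circles -/

namespace TypeD

namespace Diagram

variable {V : Type} [Fintype V] [LinearOrder V] (D : Diagram V)

theorem unmarkedSign_sq (x y : V) : D.unmarkedSign x y * D.unmarkedSign x y = 1 := by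
  rw [unmarkedSign, ← mul_pow]; simp

theorem unmarkedSign_self (x : V) : D.unmarkedSign x x = 1 := by
  have : ∀ n s, D.lengthAux .unmarked x n (x, s) = 0 := by
    rintro (_ | n) s <;> simp [lengthAux]
  rw [unmarkedSign, length, this, pow_zero]

/-- The form in which every marked sign of the adjusted rule is rewritten below. -/
theorem Alternating.markedSign_eq {D : Diagram V} (hD : D.Alternating) {x y : V}
    (h : y ∈ D.circle x) :
    D.markedSign x y = D.unmarkedSign x y * (-1) ^ D.num x * (-1) ^ D.num y := by
  rw [← hD.unmarkedSign_mul_markedSign h]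
  have h1 := D.unmarkedSign_sq x y
  have h2 : ((-1 : ℤ) ^ D.num y) * (-1) ^ D.num y = 1 := by rw [← mul_pow]; simp
  linear_combination (-D.markedSign x y) * h1 -
    D.markedSign x y * D.unmarkedSign x y * D.unmarkedSign x y * h2

theorem base_congr {D E : Diagram V} {v : V} (h : D.circle v = E.circle v) :
    D.base v = E.base v := by
  simp only [base, h]

end Diagram

namespace Stacked

variable {K : ℕ}

/-! ### Nested circles -/

/-- The points on one of the dotted lines through which the circle of `y` passes. -/
def points (S : Stacked K) (b : Bool) (y : StackedVertex K) : Finset (Fin (2 * K)) :=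
  Finset.univ.filter fun k => toLex (k, b) ∈ S.diagram.circle y

theorem mem_points_false {S : Stacked K} {y : StackedVertex K} {k : Fin (2 * K)} :
    k ∈ S.points false y ↔ lo k ∈ S.diagram.circle y := by
  simp [points, lo]

theorem mem_points_true {S : Stacked K} {y : StackedVertex K} {k : Fin (2 * K)} :
    k ∈ S.points true y ↔ up k ∈ S.diagram.circle y := by
  simp [points, up]

theorem nested_iff (S : Stacked K) (k : Fin (2 * K)) (b : Bool) (y : StackedVertex K) :
    S.Nested (toLex (k, b)) y ↔ Odd ((S.points b y).filter fun l => l < k).card := by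
  rw [Nested]
  refine iff_of_eq (congrArg Odd (Finset.card_nbij' (fun v => (ofLex v).1)
    (fun l => toLex (l, b)) ?_ ?_ ?_ ?_))
  · intro v hv
    obtain ⟨h, rfl, h'⟩ := Finset.mem_filter.1 hv
    exact Finset.mem_filter.2 ⟨Finset.mem_filter.2 ⟨Finset.mem_univ _, h⟩, h'⟩
  · intro l hl
    obtain ⟨h, h'⟩ := Finset.mem_filter.1 hl
    exact Finset.mem_filter.2 ⟨(Finset.mem_filter.1 h).2, rfl, h'⟩
  · intro v hv
    obtain ⟨h, rfl, h'⟩ := Finset.mem_filter.1 hv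
    rfl
  · exact fun l _ => rfl

section

variable {S : Stacked K} (hS : S.Valid)
include hS

theorem bot_partner_mem_points {y : StackedVertex K} {k : Fin (2 * K)} :
    S.bot.partner k ∈ S.points false y ↔ k ∈ S.points false y := by
  rw [mem_points_false, mem_points_false, ← nbr_below_lo, hS.alternating.nbr_mem_circle_iff]

theorem top_partner_mem_points {y : StackedVertex K} {k : Fin (2 * K)} :
    S.top.partner k ∈ S.points true y ↔ k ∈ S.points true y := by
  rw [mem_points_true, mem_points_true, ← nbr_above_up, hS.alternating.nbr_mem_circle_iff]

theorem mid_partner_mem_points (b : Bool) {y : StackedVertex K} {k : Fin (2 * K)}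
    (hk : k ∉ S.cut) : S.mid.partner k ∈ S.points b y ↔ k ∈ S.points b y := by
  cases b
  · have := hS.alternating.nbr_mem_circle_iff .above (v := lo k) (w := y)
    rw [nbr_above_lo, if_neg hk] at this
    rw [mem_points_false, mem_points_false, this]
  · have := hS.alternating.nbr_mem_circle_iff .below (v := up k) (w := y)
    rw [nbr_below_up, if_neg hk] at this
    rw [mem_points_true, mem_points_true, this]

theorem mem_points_true_iff_false {y : StackedVertex K} {k : Fin (2 * K)} (hk : k ∈ S.cut) :
    k ∈ S.points true y ↔ k ∈ S.points false y := by
  have := hS.alternating.nbr_mem_circle_iff .below (v := up k) (w := y)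
  rw [nbr_below_up, if_pos hk] at this
  rw [mem_points_true, mem_points_false, this]

/-- Points not yet cut are paired by the middle arcs, and no remaining middle arc passes over the
cut vertex `v`. So they do not affect the parity. -/
theorem odd_card_points_cut (b : Bool) (y : StackedVertex K) {v : Fin (2 * K)} (hv : v ∈ S.cut) :
    Odd ((S.points b y).filter fun l => l < v).card ↔
      Odd (((S.points b y).filter fun l => l < v).filter fun l => l ∈ S.cut).card := by
  rw [← Finset.card_filter_add_card_filter_not (s := (S.points b y).filter fun l => l < v)
    (fun l => l ∈ S.cut), Nat.odd_add]
  have : Even (((S.points b y).filter fun l => l < v).filter fun l => l ∉ S.cut).card := by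
    refine S.mid.even_card_of_closed _ fun k hk => ?_
    simp only [Finset.mem_filter] at hk ⊢
    refine ⟨⟨(mid_partner_mem_points hS b hk.2).2 hk.1.1, ?_⟩, by
      rw [hS.partner_mem_iff]; exact hk.2⟩
    rcases lt_trichotomy (S.mid.partner k) v with h | h | h
    · exact h
    · exact absurd ((hS.partner_mem_iff k).1 (h ▸ hv)) hk.2
    · exact absurd (hS.outer_mem v k hv hk.1.2 h) hk.2
  tauto

/-- Only cut vertices count, and there a vertical segment makes the circle meet both dotted lines or
neither. -/
theorem nested_up_iff_lo (y : StackedVertex K) {v : Fin (2 * K)} (hv : v ∈ S.cut) :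
    S.Nested (up v) y ↔ S.Nested (lo v) y := by
  rw [up, lo, nested_iff, nested_iff, odd_card_points_cut hS true y hv,
    odd_card_points_cut hS false y hv]
  have : (((S.points true y).filter fun l => l < v).filter fun l => l ∈ S.cut) =
      (((S.points false y).filter fun l => l < v).filter fun l => l ∈ S.cut) := by
    ext k
    simp only [Finset.mem_filter]
    constructor
    · exact fun h => ⟨⟨(mem_points_true_iff_false hS h.2).1 h.1.1, h.1.2⟩, h.2⟩
    · exact fun h => ⟨⟨(mem_points_true_iff_false hS h.2).2 h.1.1, h.1.2⟩, h.2⟩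
  rw [this]

/-- Surgeries proceed from outside to inside, so all middle arcs enclosed by a remaining one are
still present and pair up the points there. -/
theorem nested_mid_partner (b : Bool) (y : StackedVertex K) {v : Fin (2 * K)} (hv : v ∉ S.cut)
    (h : v ∉ S.points b y) :
    S.Nested (toLex (S.mid.partner v, b)) y ↔ S.Nested (toLex (v, b)) y := by
  rw [nested_iff, nested_iff]
  refine (S.mid.odd_card_filter_lt_partner _ v h
    (by rwa [mid_partner_mem_points hS b hv]) ?_).symm
  rintro k hk (⟨h1, h2⟩ | ⟨h1, h2⟩)
  · exact (mid_partner_mem_points hS b fun hc => hv (hS.outer_mem k v hc h1 h2)).2 hk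
  · refine (mid_partner_mem_points hS b fun hc => hv ?_).2 hk
    rw [← hS.partner_mem_iff]
    exact hS.outer_mem k _ hc h1 (by rwa [S.mid.partner_partner])

/-- The discrete Jordan curve argument: the crossing parity that defines nesting is constant along
any strand disjoint from the circle of `y`. -/
theorem nested_nbr {x y : StackedVertex K} (h : x ∉ S.diagram.circle y) (s : Side) :
    S.Nested (S.diagram.nbr s x) y ↔ S.Nested x y := by
  rcases x.exists_eq with ⟨k, rfl⟩ | ⟨k, rfl⟩
  · rw [← mem_points_false] at h
    cases s
    · rw [nbr_below_lo, lo, lo, nested_iff, nested_iff]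
      exact (S.bot.odd_card_filter_lt_partner _ k h (by rwa [bot_partner_mem_points hS])
        fun l hl _ => (bot_partner_mem_points hS).2 hl).symm
    · rw [nbr_above_lo]
      split_ifs with hk
      · exact nested_up_iff_lo hS y hk
      · exact nested_mid_partner hS false y hk h
  · rw [← mem_points_true] at h
    cases s
    · rw [nbr_below_up]
      split_ifs with hk
      · exact (nested_up_iff_lo hS y hk).symm
      · exact nested_mid_partner hS true y hk h
    · rw [nbr_above_up, up, up, nested_iff, nested_iff]
      exact (S.top.odd_card_filter_lt_partner _ k h (by rwa [top_partner_mem_points hS])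
        fun l hl _ => (top_partner_mem_points hS).2 hl).symm

/-- The base point of a nested circle lies to the left of the base point of the outer circle. -/
theorem base_lt_base_of_nested {x y : StackedVertex K} (hxy : x ∉ S.diagram.circle y)
    (h : S.Nested x y) : S.diagram.base x < S.diagram.base y := by
  have hD := hS.alternating
  have hdis : ∀ w ∈ S.diagram.circle x, w ∉ S.diagram.circle y := fun w hw hwy =>
    hxy (hD.mem_circle_trans hwy (hD.mem_circle_comm.1 hw))
  have hb : S.Nested (S.diagram.base x) y :=
    hD.circle_induction (P := fun w => S.Nested w y) h
      (fun s w hw hn => (nested_nbr hS (hdis w hw) s).2 hn) _ (S.diagram.base_mem_circle x)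
  by_contra hlt
  have hlt' : S.diagram.base y < S.diagram.base x :=
    lt_of_le_of_ne (not_lt.1 hlt) fun e => hdis _ (S.diagram.base_mem_circle x)
      (e ▸ S.diagram.base_mem_circle y)
  obtain ⟨p, b, hp⟩ : ∃ p b, S.diagram.base x = toLex (p, b) := ⟨_, _, rfl⟩
  -- If `base y` came first, all points of the circle of `y` on the line of `base x` would lie to
  -- the left of `base x`. Their number is even, since the bottom cups or the top caps pair them.
  rw [hp, nested_iff, Finset.filter_true_of_mem, ← Nat.not_even_iff_odd] at hb
  · apply hb
    cases b
    · exact S.bot.even_card_of_closed _ fun k hk => (bot_partner_mem_points hS).2 hk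
    · exact S.top.even_card_of_closed _ fun k hk => (top_partner_mem_points hS).2 hk
  · intro k hk
    have hk' := (S.diagram.le_base (by simpa [points] using hk)).trans_lt hlt'
    rw [hp, Prod.Lex.toLex_lt_toLex] at hk'
    simpa using hk'

end

/-! ### Shape of a split and positions of its base points -/

section Surgery

variable {S : Stacked K} (hS : S.Valid) {i : Fin (2 * K)} (hi : S.Available i)
include hS hi

/-- Marked pairs are removed from right to left, so nothing to the left of `i` is cut yet;
availability keeps the arcs there from passing over `i`. -/
theorem not_mem_surgery_cut_of_lt (hm : S.mid.marked i = true) {k : Fin (2 * K)} (hk : k < i) :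
    k ∉ (S.surgery i).cut ∧ S.mid.partner k < i := by
  have h1 : k ∉ S.cut := hS.not_lt_marked k i hi.1 hm hk
  have h2 : k ≠ S.mid.partner i := (hk.trans hi.2.1).ne
  refine ⟨?_, ?_⟩
  · rw [mem_surgery_cut]
    exact fun h => h.elim h1 fun h => h.elim hk.ne h2
  · rcases lt_trichotomy (S.mid.partner k) i with h | h | h
    · exact h
    · exact absurd (by rw [← h, S.mid.partner_partner]) h2
    · exact absurd ⟨hk, h⟩ (hi.2.2.1 k h1)

/-- All points to the left of `i` are paired by intact middle arcs, so the crossing parity at `i` is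
even. -/
theorem not_isCShape_of_marked (hm : S.mid.marked i = true) : ¬ IsCShape S i := by
  rw [IsCShape, lo, nested_iff, Nat.not_odd_iff_even]
  refine S.mid.even_card_of_closed _ fun k hk => ?_
  rw [Finset.mem_filter] at hk ⊢
  have h := not_mem_surgery_cut_of_lt hS hi hm hk.2
  exact ⟨(mid_partner_mem_points (hS.surgery hi) false h.1).2 hk.1, h.2⟩

/-- Of the points of `C_i` to the left of `j`, all but `i` itself are paired by middle arcs, which
lie either left of `i` or between `i` and `j`. -/
theorem isReflectedCShape_of_marked (hm : S.mid.marked i = true) : IsReflectedCShape S i := by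
  rw [IsReflectedCShape, lo, nested_iff]
  set T := ((S.surgery i).points false (lo i)).filter fun l => l < S.mid.partner i
  have hiT : i ∈ T := by
    rw [Finset.mem_filter, mem_points_false]
    exact ⟨Diagram.self_mem_circle _ _, hi.2.1⟩
  rw [← Finset.card_erase_add_one hiT]
  refine Even.add_one (S.mid.even_card_of_closed _ fun k hk => ?_)
  simp only [T, Finset.mem_erase, Finset.mem_filter] at hk ⊢
  rcases lt_or_gt_of_ne hk.1 with h | h
  · have h' := not_mem_surgery_cut_of_lt hS hi hm h
    exact ⟨h'.2.ne, (mid_partner_mem_points (hS.surgery hi) false h'.1).2 hk.2.1,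
      h'.2.trans hi.2.1⟩
  · have h' := S.mid.noncrossing i k h hk.2.2
    refine ⟨h'.1.ne', (mid_partner_mem_points (hS.surgery hi) false ?_).2 hk.2.1, h'.2⟩
    rw [mem_surgery_cut]
    rintro (hc | hc | hc)
    · exact hi.1 (hS.outer_mem k i hc h hk.2.2)
    · exact hk.1 hc
    · exact hk.2.2.ne hc

theorem base_lt_base_of_isReflectedCShape (h : up i ∈ S.diagram.circle (lo i))
    (hc : IsReflectedCShape S i) : (S.surgery i).diagram.base (lo (S.mid.partner i)) <
      (S.surgery i).diagram.base (lo i) :=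
  base_lt_base_of_nested (hS.surgery hi) (partner_not_mem_of_split hS hi h) hc

theorem base_lt_base_of_isCShape (h : up i ∈ S.diagram.circle (lo i))
    (hc : IsCShape S i) : (S.surgery i).diagram.base (lo i) <
      (S.surgery i).diagram.base (lo (S.mid.partner i)) :=
  base_lt_base_of_nested (hS.surgery hi) (by
    rw [(hS.surgery hi).alternating.mem_circle_comm]
    exact partner_not_mem_of_split hS hi h) hc

theorem base_of_split_of_lt (h : up i ∈ S.diagram.circle (lo i))
    (hlt : (S.surgery i).diagram.base (lo (S.mid.partner i)) < (S.surgery i).diagram.base (lo i)) :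
    S.diagram.base (lo i) = (S.surgery i).diagram.base (lo i) := by
  have hc := circle_of_split hS hi h
  refine le_antisymm ?_ (S.diagram.le_base ?_)
  · have := S.diagram.base_mem_circle (lo i)
    rw [hc, Finset.mem_union] at this
    rcases this with h' | h'
    · exact Diagram.le_base _ h'
    · exact (Diagram.le_base _ h').trans hlt.le
  · rw [hc, Finset.mem_union]
    exact Or.inl (Diagram.base_mem_circle _ _)

theorem base_of_split_of_gt (h : up i ∈ S.diagram.circle (lo i))
    (hlt : (S.surgery i).diagram.base (lo i) < (S.surgery i).diagram.base (lo (S.mid.partner i))) :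
    S.diagram.base (lo i) = (S.surgery i).diagram.base (lo (S.mid.partner i)) := by
  have hc := circle_of_split hS hi h
  refine le_antisymm ?_ (S.diagram.le_base ?_)
  · have := S.diagram.base_mem_circle (lo i)
    rw [hc, Finset.mem_union] at this
    rcases this with h' | h'
    · exact (Diagram.le_base _ h').trans hlt.le
    · exact Diagram.le_base _ h'
  · rw [hc, Finset.mem_union]
    exact Or.inr (Diagram.base_mem_circle _ _)

/-! ### Rescaling factors before and after a surgery -/

/-- The circles away from the surgery keep their base points and labels, so they contribute a common
factor `R`. -/
theorem coeff_merge (h : up i ∉ S.diagram.circle (lo i)) {o o' : StackedVertex K → Label}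
    (hoo : ∀ v, v ∉ S.diagram.circle (lo i) → v ∉ S.diagram.circle (up i) → o' v = o v) :
    ∃ R : ℤ, S.diagram.coeff o = S.diagram.coeffAt o (lo i) * S.diagram.coeffAt o (up i) * R ∧
      (S.surgery i).diagram.coeff o' = (S.surgery i).diagram.coeffAt o' (lo i) * R := by
  have hD := hS.alternating
  have hE := (hS.surgery hi).alternating
  have hd : Disjoint (S.diagram.circle (lo i)) (S.diagram.circle (up i)) := by
    rw [Finset.disjoint_left]
    exact fun x h1 h2 => h (hD.mem_circle_trans h1 (hD.mem_circle_comm.1 h2))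
  refine ⟨∏ v ∈ (S.diagram.circle (lo i) ∪ S.diagram.circle (up i))ᶜ,
    if S.diagram.base v = v ∧ o v = .vee then -(-1) ^ S.diagram.num v else 1, ?_, ?_⟩
  · rw [hD.coeff_eq, ← hD.prod_circle, ← hD.prod_circle, ← Finset.prod_union hd,
      Finset.prod_mul_prod_compl]
  · rw [hE.coeff_eq, ← hE.prod_circle, surgery_circle_of_merge hS hi h,
      ← Finset.prod_mul_prod_compl (S.diagram.circle (lo i) ∪ S.diagram.circle (up i))]
    congr 1
    refine Finset.prod_congr rfl fun v hv => ?_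
    simp only [Finset.mem_compl, Finset.mem_union, not_or] at hv
    rw [Diagram.base_congr (surgery_circle_of_not_mem hS hi hv.1 hv.2), hoo v hv.1 hv.2]
    rfl

theorem coeff_split (h : up i ∈ S.diagram.circle (lo i)) {o o' : StackedVertex K → Label}
    (hoo : ∀ v, v ∉ S.diagram.circle (lo i) → v ∉ S.diagram.circle (up i) → o' v = o v) :
    ∃ R : ℤ, S.diagram.coeff o = S.diagram.coeffAt o (lo i) * R ∧
      (S.surgery i).diagram.coeff o' = (S.surgery i).diagram.coeffAt o' (lo i) *
        (S.surgery i).diagram.coeffAt o' (lo (S.mid.partner i)) * R := by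
  have hD := hS.alternating
  have hE := (hS.surgery hi).alternating
  have hup := hD.circle_eq h
  refine ⟨∏ v ∈ (S.diagram.circle (lo i))ᶜ,
    if S.diagram.base v = v ∧ o v = .vee then -(-1) ^ S.diagram.num v else 1, ?_, ?_⟩
  · rw [hD.coeff_eq, ← hD.prod_circle, Finset.prod_mul_prod_compl]
  · rw [hE.coeff_eq, ← hE.prod_circle, ← hE.prod_circle,
      ← Finset.prod_union (disjoint_of_split hS hi h), ← circle_of_split hS hi h,
      ← Finset.prod_mul_prod_compl (S.diagram.circle (lo i))]
    congr 1
    refine Finset.prod_congr rfl fun v hv => ?_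
    rw [Finset.mem_compl] at hv
    have hv' : v ∉ S.diagram.circle (up i) := by rwa [hup]
    rw [Diagram.base_congr (surgery_circle_of_not_mem hS hi hv hv'), hoo v hv hv']
    rfl

omit hS hi in
theorem nbr_surgery_eq {s : Side} {v : StackedVertex K}
    (h : S.diagram.nbr s v ≠ (S.surgery i).diagram.nbr s v ∨
      S.diagram.kind s v ≠ (S.surgery i).diagram.kind s v) :
    ∃ k, (k = i ∨ k = S.mid.partner i) ∧ ((v = lo k ∧ s = .above) ∨ (v = up k ∧ s = .below)) := by
  rcases v.exists_eq with ⟨k, rfl⟩ | ⟨k, rfl⟩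
  · cases s
    · exact absurd h (by simp [surgery])
    · by_contra! hk
      have h3 : k ≠ i := fun e => (hk k (Or.inl e)).1 rfl rfl
      have h4 : k ≠ S.mid.partner i := fun e => (hk k (Or.inr e)).1 rfl rfl
      refine absurd h ?_
      simp [surgery, h3, h4]
  · cases s
    · by_contra! hk
      have h3 : k ≠ i := fun e => (hk k (Or.inl e)).2 rfl rfl
      have h4 : k ≠ S.mid.partner i := fun e => (hk k (Or.inr e)).2 rfl rfl
      refine absurd h ?_
      simp [surgery, h3, h4]
    · exact absurd h (by simp [surgery])

omit hS in
theorem sign_partner {o : StackedVertex K → Label} (ho : S.diagram.IsOrientation o) :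
    (o (lo (S.mid.partner i))).sign * (o (lo i)).sign = (-1) ^ unmarkedType S i ∧
    (o (up (S.mid.partner i))).sign * (o (up i)).sign = (-1) ^ unmarkedType S i := by
  have h1 := ho .above (lo i)
  have h2 := ho .below (up i)
  simp only [nbr_above_lo, kind_above_lo, nbr_below_up, kind_below_up, hi.1, if_false,
    CupDiagram.kind] at h1 h2
  rw [unmarkedType]
  cases hm : S.mid.marked i
  · simp only [hm, Bool.false_eq_true, if_false, if_true] at h1 h2 ⊢
    rw [Label.sign_eq_neg_of_ne h1, Label.sign_eq_neg_of_ne h2]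
    simp [Label.sign_mul_self]
  · simp only [hm, if_true, reduceCtorEq, if_false] at h1 h2 ⊢
    rw [h1, h2]
    simp [Label.sign_mul_self]

/-- Going from one of the two new circles to the other in the diagram before the surgery, one
passes the arc at which the surgery is performed. -/
theorem sign_split (h : up i ∈ S.diagram.circle (lo i)) {o o' : StackedVertex K → Label}
    (ho : S.diagram.IsOrientation o) (ho' : (S.surgery i).diagram.IsOrientation o')
    {x y : StackedVertex K} (hx : x ∈ (S.surgery i).diagram.circle (lo i))
    (hy : y ∈ (S.surgery i).diagram.circle (lo (S.mid.partner i))) :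
    (o x).sign * (o y).sign * ((o' x).sign * (o' (lo i)).sign) *
      ((o' y).sign * (o' (lo (S.mid.partner i))).sign) = (-1) ^ unmarkedType S i := by
  have hD := hS.alternating
  have hE := (hS.surgery hi).alternating
  have hcirc := circle_of_split hS hi h
  have hdis := disjoint_of_split hS hi h
  obtain ⟨hlo, hup⟩ := sign_partner hi ho
  set j := S.mid.partner i with hj
  have hci : i ∈ (S.surgery i).cut := by simp [mem_surgery_cut]
  have hcj : j ∈ (S.surgery i).cut := by simp [mem_surgery_cut, hj]
  have hoi : o' (up i) = o' (lo i) := by simpa [hci] using ho' .above (lo i)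
  have hoj : o' (up j) = o' (lo j) := by simpa [hcj] using ho' .above (lo j)
  have hui : up i ∈ (S.surgery i).diagram.circle (lo i) := by
    rw [← surgery_circle_up hS hi hci]; exact Diagram.self_mem_circle _ _
  have huj : up j ∈ (S.surgery i).diagram.circle (lo j) := by
    rw [← surgery_circle_up hS hi hcj]; exact Diagram.self_mem_circle _ _
  have hli := Diagram.self_mem_circle (S.surgery i).diagram (lo i)
  have hlj := Diagram.self_mem_circle (S.surgery i).diagram (lo j)
  have hlj' := Finset.disjoint_right.1 hdis hlj
  have huj' := Finset.disjoint_right.1 hdis huj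
  have hjc : j ∉ S.cut := by rw [hj, hS.partner_mem_iff]; exact hi.1
  have hjj : S.mid.partner j = i := by rw [hj, S.mid.partner_partner]
  -- Along a strand common to both diagrams `o` and `o'` change sign together. The old circle also
  -- uses the removed arcs, which jump between the new circles; `κ`, constant on each new circle,
  -- compensates for the jump and makes `ρ` constant on the whole old circle.
  let κ : StackedVertex K → ℤ := fun v => if v ∈ (S.surgery i).diagram.circle (lo i)
    then (o' (lo i)).sign else (o' (lo j)).sign * (-1) ^ unmarkedType S i
  let ρ : StackedVertex K → ℤ := fun v => (o v).sign * (o' v).sign * κ v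
  have hρlo : ρ (lo j) = ρ (lo i) := by
    simp only [ρ, κ, if_pos hli, if_neg hlj', ← hlo]
    linear_combination (o (lo i)).sign * (o (lo j)).sign ^ 2 * Label.sign_mul_self (o' (lo j))
      + (o (lo i)).sign * Label.sign_mul_self (o (lo j))
      - (o (lo i)).sign * Label.sign_mul_self (o' (lo i))
  have hρup : ρ (up j) = ρ (up i) := by
    simp only [ρ, κ, if_pos hui, if_neg huj', ← hup, hoi, hoj]
    linear_combination (o (up i)).sign * (o (up j)).sign ^ 2 * Label.sign_mul_self (o' (lo j))
      + (o (up i)).sign * Label.sign_mul_self (o (up j))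
      - (o (up i)).sign * Label.sign_mul_self (o' (lo i))
  have hconst : ∀ w ∈ S.diagram.circle (lo i), ρ w = ρ (lo i) := by
    refine hD.circle_induction rfl fun s w hw hρ => ?_
    rw [← hρ]
    by_cases hsame : S.diagram.nbr s w = (S.surgery i).diagram.nbr s w ∧
        S.diagram.kind s w = (S.surgery i).diagram.kind s w
    · have h1 := ho s w
      have h2 := ho' s w
      rw [← hsame.1, ← hsame.2] at h2
      have hκ : κ (S.diagram.nbr s w) = κ w := by
        have := hE.nbr_mem_circle_iff s (v := w) (w := lo i)
        rw [← hsame.1] at this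
        simp only [κ, this]
      simp only [ρ, hκ]
      split_ifs at h1 h2
      · rw [Label.sign_eq_neg_of_ne h1, Label.sign_eq_neg_of_ne h2]
        ring
      · rw [h1, h2]
    · rw [not_and_or] at hsame
      obtain ⟨k, rfl | hk, ⟨rfl, rfl⟩ | ⟨rfl, rfl⟩⟩ := nbr_surgery_eq hsame
      · simpa [hi.1] using hρlo
      · simpa [hi.1] using hρup
      · rw [← hj] at hk
        subst k
        simpa [hjc, hjj] using hρlo.symm
      · rw [← hj] at hk
        subst k
        simpa [hjc, hjj] using hρup.symm
  have h1 : ρ x = ρ y := by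
    rw [hconst x (by rw [hcirc]; exact Finset.mem_union_left _ hx),
      hconst y (by rw [hcirc]; exact Finset.mem_union_right _ hy)]
  simp only [ρ, κ, if_pos hx, if_neg (Finset.disjoint_right.1 hdis hy)] at h1
  generalize (-1 : ℤ) ^ unmarkedType S i = t at *
  calc _ = ((o x).sign * (o' x).sign * (o' (lo i)).sign) *
        ((o y).sign * (o' y).sign * (o' (lo j)).sign) := by ring
    _ = t * ((o y).sign * (o y).sign) * ((o' y).sign * (o' y).sign) *
        ((o' (lo j)).sign * (o' (lo j)).sign) := by rw [h1]; ring
    _ = t := by simp only [Label.sign_mul_self, mul_one]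

end Surgery

end Stacked

end TypeD

/-! ### The local identity for one surgery -/

namespace TypeD

theorem Diagram.coeffAt_of_clockwise {V : Type} [Fintype V] [LinearOrder V] {D : Diagram V}
    {o : V → Label} {v : V} (h : D.Clockwise o v) :
    D.coeffAt o v = -(-1) ^ D.num (D.base v) := if_pos h

theorem Diagram.coeffAt_of_not_clockwise {V : Type} [Fintype V] [LinearOrder V] {D : Diagram V}
    {o : V → Label} {v : V} (h : ¬ D.Clockwise o v) : D.coeffAt o v = 1 := if_neg h

section LocalIdentity

variable {K : ℕ} {S : Stacked K} (hS : S.Valid) {i : Fin (2 * K)} (hi : S.Available i)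
include hS hi

open Stacked

/-- The signs run between the base points before and after, so their discrepancy is exactly the
quotient of the coefficients of the two clockwise circles. -/
theorem arcSigns_merge {o o' : StackedVertex K → Label} (h : up i ∉ S.diagram.circle (lo i))
    {x : StackedVertex K} (hx : x = lo i ∨ x = up i) (hc : S.diagram.Clockwise o x)
    (hc' : (S.surgery i).diagram.Clockwise o' (lo i)) :
    arcSigns.merge S i x * (S.surgery i).diagram.coeffAt o' (lo i) =
      S.diagram.coeffAt o x * adjustedSigns.merge S i x := by
  have hE := (hS.surgery hi).alternating
  have hmem : S.diagram.base x ∈ (S.surgery i).diagram.circle (lo i) := by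
    have := S.diagram.base_mem_circle x
    rw [surgery_circle_of_merge hS hi h, Finset.mem_union]
    rcases hx with rfl | rfl
    exacts [Or.inl this, Or.inr this]
  have hb : (S.surgery i).diagram.base (lo i) ∈
      (S.surgery i).diagram.circle (S.diagram.base x) := by
    rw [hE.circle_eq hmem]
    exact Diagram.base_mem_circle _ _
  simp only [arcSigns, adjustedSigns]
  rw [hE.markedSign_eq hb, Diagram.coeffAt_of_clockwise hc', Diagram.coeffAt_of_clockwise hc]
  change _ = -(-1) ^ S.diagram.num _ * (_ * (-1) ^ S.diagram.num _ * _)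
  have h2 : ((-1 : ℤ) ^ S.diagram.num (S.diagram.base x)) *
    (-1) ^ S.diagram.num (S.diagram.base x) = 1 := by rw [← mul_pow]; simp
  linear_combination ((S.surgery i).diagram.unmarkedSign (S.diagram.base x)
    ((S.surgery i).diagram.base (lo i)) *
    (-1) ^ (S.surgery i).diagram.num ((S.surgery i).diagram.base (lo i))) * h2

/-- The parities of `i` and the base point turn the unmarked sign into the marked one, leaving
`-(-1)^utype = (-1)^mtype`. This is the nesting factor, because a marked split always has the
reflected C shape. -/
theorem arcSigns_splitLeft {o' : StackedVertex K → Label}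
    (hc : (S.surgery i).diagram.Clockwise o' (lo i)) :
    arcSigns.splitLeft S i * (S.surgery i).diagram.coeffAt o' (lo i) =
      adjustedSigns.splitLeft S i := by
  have hE := (hS.surgery hi).alternating
  simp only [arcSigns, adjustedSigns]
  rw [hE.markedSign_eq (Diagram.base_mem_circle _ _), Diagram.coeffAt_of_clockwise hc, num_lo]
  cases hm : S.mid.marked i
  · simp only [unmarkedType, markedType, hm]
    simp
  · simp only [unmarkedType, markedType, hm, isReflectedCShape_of_marked hS hi hm]
    simp

omit hS hi in
theorem neg_one_pow_partner :
    (-1 : ℤ) ^ vertexNumber (S.mid.partner i) = -(-1) ^ vertexNumber i := by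
  have h := S.mid.odd_vertexNumber_add i
  have : (-1 : ℤ) ^ (vertexNumber (S.mid.partner i) + vertexNumber i) = -1 := h.neg_one_pow
  rw [pow_add] at this
  rcases neg_one_pow_eq_or ℤ (vertexNumber i) with h | h <;> rw [h] at this ⊢ <;> linarith

/-- Here the parity of `i` appears where that of `j` is needed; the resulting sign cancels the one
in the coefficient. The nesting factor is trivial, as a marked split never has the C shape. -/
theorem arcSigns_splitRight {o' : StackedVertex K → Label}
    (hc : (S.surgery i).diagram.Clockwise o' (lo (S.mid.partner i))) :
    arcSigns.splitRight S i * (S.surgery i).diagram.coeffAt o' (lo (S.mid.partner i)) =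
      adjustedSigns.splitRight S i := by
  have hE := (hS.surgery hi).alternating
  simp only [arcSigns, adjustedSigns]
  rw [hE.markedSign_eq (Diagram.base_mem_circle _ _), Diagram.coeffAt_of_clockwise hc, num_lo,
    neg_one_pow_partner]
  cases hm : S.mid.marked i
  · simp only [markedType, hm]
    simp
  · simp only [not_isCShape_of_marked hS hi hm]
    simp

/-- Written as label signs, the unmarked signs for `B_be → B_j`, `i → B_i` and `j → B_j` multiply to
`(-1)^utype` by `sign_split`. Hence the first two together with `(-1)^utype` equal the third. -/
theorem arcSigns_splitBoth_of_lt {o o' : StackedVertex K → Label}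
    (h : up i ∈ S.diagram.circle (lo i)) (ho : S.diagram.IsOrientation o)
    (ho' : (S.surgery i).diagram.IsOrientation o')
    (hb : S.diagram.base (lo i) = (S.surgery i).diagram.base (lo i)) :
    arcSigns.splitBoth S i * (-1) ^ S.diagram.num (S.diagram.base (lo i)) *
      (-1) ^ S.diagram.num ((S.surgery i).diagram.base (lo (S.mid.partner i))) =
      -(-1) ^ S.diagram.num (S.diagram.base (lo i)) *
        (S.surgery i).diagram.markedSign (lo (S.mid.partner i))
          ((S.surgery i).diagram.base (lo (S.mid.partner i))) := by
  have hD := hS.alternating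
  have hE := (hS.surgery hi).alternating
  have hbi := (S.surgery i).diagram.base_mem_circle (lo i)
  have hbj := (S.surgery i).diagram.base_mem_circle (lo (S.mid.partner i))
  have hs := sign_split hS hi h ho ho' hbi hbj
  rw [hE.markedSign_eq hbj, num_lo, neg_one_pow_partner]
  change _ = _ * (_ * _ * (-1) ^ S.diagram.num _)
  have hw : (S.surgery i).diagram.base (lo (S.mid.partner i)) ∈
      S.diagram.circle (S.diagram.base (lo i)) := by
    rw [hD.circle_eq (S.diagram.base_mem_circle _), circle_of_split hS hi h]
    exact Finset.mem_union_right _ hbj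
  have e1 := hD.unmarkedSign_eq ho hw
  have e2 := hE.unmarkedSign_eq ho' hbi
  have e3 := hE.unmarkedSign_eq ho' hbj
  simp only [arcSigns]
  rw [hb] at e1 ⊢
  rw [← hs]
  generalize (S.surgery i).diagram.base (lo i) = x at *
  generalize (S.surgery i).diagram.base (lo (S.mid.partner i)) = y at *
  rw [← e1, ← e2, ← e3]
  have q1 := S.diagram.unmarkedSign_sq x y
  have q2 := (S.surgery i).diagram.unmarkedSign_sq (lo i) x
  have q3 := Label.sign_mul_self (o y)
  have q4 := Label.sign_mul_self (o' x)
  have q5 := Label.sign_mul_self (o' y)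
  generalize S.diagram.unmarkedSign x y = a at *
  generalize (S.surgery i).diagram.unmarkedSign (lo i) x = b at *
  generalize (S.surgery i).diagram.unmarkedSign (lo (S.mid.partner i)) y = c at *
  generalize (o y).sign = s at *
  generalize (o' x).sign = t at *
  generalize (o' y).sign = r at *
  generalize (-1 : ℤ) ^ S.diagram.num x = β
  generalize (-1 : ℤ) ^ S.diagram.num y = γ
  generalize (-1 : ℤ) ^ vertexNumber i = ι
  calc _ = (a * a) * (b * b) * (s * s) * (t * t) * (r * r) * (c * ι * β * γ) := by ring
    _ = _ := by rw [q1, q2, q3, q4, q5]; ring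

/-- The path between base points is trivial because `B_be = B_j`, so no comparison of labels is
needed. -/
theorem arcSigns_splitBoth_of_gt (hm : S.mid.marked i = false)
    (hb : S.diagram.base (lo i) = (S.surgery i).diagram.base (lo (S.mid.partner i))) :
    arcSigns.splitBoth S i * (-1) ^ S.diagram.num ((S.surgery i).diagram.base (lo i)) *
      (-1) ^ S.diagram.num ((S.surgery i).diagram.base (lo (S.mid.partner i))) =
      -(-1) ^ S.diagram.num (S.diagram.base (lo i)) *
        (S.surgery i).diagram.markedSign (lo i) ((S.surgery i).diagram.base (lo i)) := by
  have hE := (hS.surgery hi).alternating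
  have hbi := (S.surgery i).diagram.base_mem_circle (lo i)
  rw [hE.markedSign_eq hbi, num_lo]
  change _ = _ * (_ * _ * (-1) ^ S.diagram.num _)
  simp only [arcSigns]
  rw [hb, Diagram.unmarkedSign_self]
  simp only [unmarkedType, hm]
  simp
  ring

/-- In every case the adjusted rule measures on the new circle without `B_be`, the inner one if the
two are nested. That circle is `C_i` only in the C shape or unnested case, and then the surgery is
unmarked. -/
theorem arcSigns_splitBoth {o o' : StackedVertex K → Label}
    (h : up i ∈ S.diagram.circle (lo i)) (ho : S.diagram.IsOrientation o)
    (ho' : (S.surgery i).diagram.IsOrientation o')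
    (hc : S.diagram.Clockwise o (lo i))
    (hci : (S.surgery i).diagram.Clockwise o' (lo i))
    (hcj : (S.surgery i).diagram.Clockwise o' (lo (S.mid.partner i))) :
    arcSigns.splitBoth S i * ((S.surgery i).diagram.coeffAt o' (lo i) *
      (S.surgery i).diagram.coeffAt o' (lo (S.mid.partner i))) =
      S.diagram.coeffAt o (lo i) * adjustedSigns.splitBoth S i := by
  have hE := (hS.surgery hi).alternating
  rw [Diagram.coeffAt_of_clockwise hci, Diagram.coeffAt_of_clockwise hcj,
    Diagram.coeffAt_of_clockwise hc]
  rw [neg_mul_neg, ← mul_assoc]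
  have hbi := (S.surgery i).diagram.base_mem_circle (lo i)
  have hbj := (S.surgery i).diagram.base_mem_circle (lo (S.mid.partner i))
  have hne : (S.surgery i).diagram.base (lo i) ≠
      (S.surgery i).diagram.base (lo (S.mid.partner i)) := fun e =>
    Finset.disjoint_left.1 (disjoint_of_split hS hi h) hbi (e ▸ hbj)
  have hlt := fun hb => arcSigns_splitBoth_of_lt hS hi h ho ho' hb
  have hgt := fun hm hb => arcSigns_splitBoth_of_gt hS hi hm hb
  simp only [adjustedSigns]
  by_cases hr : IsReflectedCShape S i
  · rw [if_pos hr]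
    have hb := base_of_split_of_lt hS hi h (base_lt_base_of_isReflectedCShape hS hi h hr)
    rw [← hlt hb, hb]
    rfl
  have hm : S.mid.marked i = false := by
    by_contra hm
    exact hr (isReflectedCShape_of_marked hS hi (by simpa using hm))
  rw [if_neg hr]
  by_cases hcs : IsCShape S i
  · rw [if_pos hcs]
    exact hgt hm (base_of_split_of_gt hS hi h (base_lt_base_of_isCShape hS hi h hcs))
  rw [if_neg hcs]
  rcases lt_or_gt_of_ne hne with hl | hl
  · have hb := base_of_split_of_gt hS hi h hl
    rw [if_neg]
    · exact hgt hm hb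
    · rw [hb]
      exact Finset.disjoint_right.1 (disjoint_of_split hS hi h) hbj
  · have hb := base_of_split_of_lt hS hi h hl
    rw [if_pos (hb ▸ hbi), ← hlt hb, hb]
    rfl

/-- The rescaling intertwines the two sign rules in each surgery. -/
theorem surgeryCoeff_mul_coeff {o : StackedVertex K → Label} (ho : S.diagram.IsOrientation o)
    (o' : StackedVertex K → Label) :
    surgeryCoeff arcSigns S i o o' * (S.surgery i).diagram.coeff o' =
      S.diagram.coeff o * surgeryCoeff adjustedSigns S i o o' := by
  unfold surgeryCoeff
  dsimp only
  by_cases h1 : (S.surgery i).diagram.IsOrientation o' ∧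
      ∀ v, v ∉ S.diagram.circle (lo i) → v ∉ S.diagram.circle (up i) → o' v = o v
  swap
  · simp only [if_neg h1, zero_mul, mul_zero]
  simp only [if_pos h1]
  by_cases h2 : up i ∈ S.diagram.circle (lo i)
  · obtain ⟨R, hR, hR'⟩ := coeff_split hS hi h2 h1.2
    rw [hR, hR']
    simp only [if_pos h2]
    by_cases hc : S.diagram.Clockwise o (lo i)
    · simp only [if_pos hc]
      by_cases hc' : (S.surgery i).diagram.Clockwise o' (lo i) ∧
          (S.surgery i).diagram.Clockwise o' (lo (S.mid.partner i))
      · simp only [if_pos hc']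
        rw [← mul_assoc, arcSigns_splitBoth hS hi h2 ho h1.1 hc hc'.1 hc'.2]
        ring
      · simp only [if_neg hc', zero_mul, mul_zero]
    · simp only [if_neg hc, Diagram.coeffAt_of_not_clockwise hc]
      by_cases hci : (S.surgery i).diagram.Clockwise o' (lo i)
      · by_cases hcj : (S.surgery i).diagram.Clockwise o' (lo (S.mid.partner i))
        · simp [hci, hcj]
        · simp only [hci, hcj, not_false_eq_true, and_self, if_true,
            Diagram.coeffAt_of_not_clockwise hcj]
          rw [← arcSigns_splitLeft hS hi hci]
          ring
      · by_cases hcj : (S.surgery i).diagram.Clockwise o' (lo (S.mid.partner i))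
        · simp only [hci, hcj, not_false_eq_true, not_true_eq_false, and_self, if_true, if_false,
            Diagram.coeffAt_of_not_clockwise hci]
          rw [← arcSigns_splitRight hS hi hcj]
          ring
        · simp [hci, hcj]
  · obtain ⟨R, hR, hR'⟩ := coeff_merge hS hi h2 h1.2
    rw [hR, hR']
    simp only [if_neg h2]
    by_cases hcl : S.diagram.Clockwise o (lo i)
    · by_cases hcu : S.diagram.Clockwise o (up i)
      · simp [hcl, hcu]
      · by_cases hc' : (S.surgery i).diagram.Clockwise o' (lo i)
        · simp only [hcl, hcu, hc', if_true, if_false, Diagram.coeffAt_of_not_clockwise hcu]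
          rw [← mul_assoc, arcSigns_merge hS hi h2 (Or.inl rfl) hcl hc']
          ring
        · simp [hcl, hcu, hc']
    · by_cases hcu : S.diagram.Clockwise o (up i)
      · by_cases hc' : (S.surgery i).diagram.Clockwise o' (lo i)
        · simp only [hcl, hcu, hc', if_true, if_false, Diagram.coeffAt_of_not_clockwise hcl]
          rw [← mul_assoc, arcSigns_merge hS hi h2 (Or.inr rfl) hcu hc']
          ring
        · simp [hcl, hcu, hc']
      · by_cases hc' : (S.surgery i).diagram.Clockwise o' (lo i)
        · simp [hcl, hcu, hc']
        · simp [hcl, hcu, hc', Diagram.coeffAt_of_not_clockwise hc',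
            Diagram.coeffAt_of_not_clockwise hcl, Diagram.coeffAt_of_not_clockwise hcu]

end LocalIdentity

/-! ### Iterating the surgeries -/

variable {K : ℕ}

theorem isOrientation_of_surgeryCoeff_ne_zero {σ : SignRule} {S : Stacked K} {i : Fin (2 * K)}
    {o o' : StackedVertex K → Label} (h : surgeryCoeff σ S i o o' ≠ 0) :
    (S.surgery i).diagram.IsOrientation o' := by
  by_contra hc
  exact h (by simp [surgeryCoeff, hc])

/-- Besides the rescaling identity, the induction carries that `f` is supported on orientations,
which the local identity requires. `hn` ensures that the surgeries suffice to cut the whole middle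
section. -/
theorem surgeries_mul_coeff (n : ℕ) {S : Stacked K} (hS : S.Valid)
    (hn : S.cut.card + 2 * n = 2 * K) (f g : (StackedVertex K → Label) → ℤ) (a : ℤ)
    (hf : ∀ o, f o ≠ 0 → S.diagram.IsOrientation o)
    (hfg : ∀ o, f o * S.diagram.coeff o = a * g o) (o : StackedVertex K → Label) :
    surgeries arcSigns n S f o * (Stacked.mk S.bot S.mid S.top Finset.univ).diagram.coeff o =
      a * surgeries adjustedSigns n S g o := by
  induction n generalizing S f g with
  | zero =>
    have : S.cut = Finset.univ := by
      rw [← Finset.card_eq_iff_eq_univ, Fintype.card_fin]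
      exact hn
    rw [← this]
    exact hfg o
  | succ n ih =>
    rw [surgeries, surgeries]
    -- The count `hn` excludes the first case, but the identity at hand settles it directly.
    rcases hl : S.leftmost with _ | i
    · rw [← Stacked.cut_eq_univ_of_leftmost hS hl]
      exact hfg o
    · have hi := Stacked.leftmost_available hl
      refine ih (hS.surgery hi) (by rw [Stacked.card_surgery_cut hS hi]; omega) _ _ ?_ ?_
      · intro o' ho'
        obtain ⟨o, -, ho⟩ := Finset.exists_ne_zero_of_sum_ne_zero ho'
        exact isOrientation_of_surgeryCoeff_ne_zero (right_ne_zero_of_mul ho)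
      · intro o'
        rw [Finset.sum_mul, Finset.mul_sum]
        refine Finset.sum_congr rfl fun o _ => ?_
        rw [← mul_assoc, ← hfg o]
        by_cases h0 : f o = 0
        · simp [h0]
        · rw [mul_assoc, surgeryCoeff_mul_coeff hS hi (hf o h0), mul_assoc]

/-! ### The first and the last diagram -/

theorem valid_empty (c d c' : CupDiagram K) : (Stacked.mk c d c' ∅).Valid where
  partner_mem _ h := absurd h (Finset.notMem_empty _)
  outer_mem _ _ h := absurd h (Finset.notMem_empty _)
  not_lt_marked _ _ _ _ _ := Finset.notMem_empty _

theorem valid_univ (c d c' : CupDiagram K) : (Stacked.mk c d c' Finset.univ).Valid where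
  partner_mem _ _ := Finset.mem_univ _
  outer_mem _ _ _ _ _ := Finset.mem_univ _
  not_lt_marked _ _ h := absurd (Finset.mem_univ _) h

theorem isOrientation_glue {c d c' : CupDiagram K} {u v : Weight K} (hcu : c.OrientedBy u)
    (hdu : d.OrientedBy u) (hdv : d.OrientedBy v) (hcv : c'.OrientedBy v) :
    (Stacked.mk c d c' ∅).diagram.IsOrientation (glue u v) := by
  have key : ∀ {e : CupDiagram K} {w : Weight K}, e.OrientedBy w → ∀ i,
      if e.kind i = .unmarked then w (e.partner i) ≠ w i else w (e.partner i) = w i := by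
    intro e w h i
    have := h i
    rw [CupDiagram.kind]
    cases hm : e.marked i <;> simpa [hm] using this
  rintro (_ | _) x <;> rcases x.exists_eq with ⟨i, rfl⟩ | ⟨i, rfl⟩
  · exact key hcu i
  · simpa using key hdv i
  · simpa using key hdu i
  · exact key hcv i

theorem prod_stackedVertex (f : StackedVertex K → ℤ) :
    ∏ v, f v = (∏ i, f (lo i)) * ∏ i, f (up i) := by
  have h : ∏ v, f v = ∏ p : Fin (2 * K) × Bool, f (toLex p) :=
    (Fintype.prod_equiv toLex _ _ fun _ => rfl).symm
  rw [h, Fintype.prod_prod_type, ← Finset.prod_mul_distrib]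
  refine Finset.prod_congr rfl fun i _ => ?_
  rw [Fintype.prod_bool, mul_comm]
  rfl

/-- Before any surgery the two halves of the stack are disconnected, and the lower half is a copy of
its circle diagram. -/
theorem base_lo_empty (c d c' : CupDiagram K) (i : Fin (2 * K)) :
    (Stacked.mk c d c' ∅).diagram.base (lo i) = lo ((circleDiagram c d).base i) := by
  have hE := (valid_empty c d c').alternating
  have hC := circleDiagram_alternating c d
  have h1 := hE.circle_induction (v := lo i)
    (P := fun w => ∃ k, w = lo k ∧ k ∈ (circleDiagram c d).circle i)
    ⟨i, rfl, Diagram.self_mem_circle _ _⟩ (by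
      rintro (_ | _) w - ⟨k, rfl, hk⟩
      · exact ⟨c.partner k, rfl, (hC.nbr_mem_circle_iff .below).2 hk⟩
      · exact ⟨d.partner k, by simp, (hC.nbr_mem_circle_iff .above).2 hk⟩)
  have h2 := hC.circle_induction (v := i)
    (P := fun k => lo k ∈ (Stacked.mk c d c' ∅).diagram.circle (lo i))
    (Diagram.self_mem_circle _ _) (by
      rintro (_ | _) k - hk
      · exact (hE.nbr_mem_circle_iff .below).2 hk
      · change lo (d.partner k) ∈ _
        simpa using (hE.nbr_mem_circle_iff .above).2 hk)
  refine le_antisymm ?_ (Diagram.le_base _ (h2 _ (Diagram.base_mem_circle _ _)))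
  obtain ⟨k, hk, hk'⟩ := h1 _ (Diagram.base_mem_circle _ _)
  rw [hk, ← not_lt, lo_lt_lo, not_lt]
  exact Diagram.le_base _ hk'

theorem base_up_empty (c d c' : CupDiagram K) (i : Fin (2 * K)) :
    (Stacked.mk c d c' ∅).diagram.base (up i) = up ((circleDiagram d c').base i) := by
  have hE := (valid_empty c d c').alternating
  have hC := circleDiagram_alternating d c'
  have h1 := hE.circle_induction (v := up i)
    (P := fun w => ∃ k, w = up k ∧ k ∈ (circleDiagram d c').circle i)
    ⟨i, rfl, Diagram.self_mem_circle _ _⟩ (by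
      rintro (_ | _) w - ⟨k, rfl, hk⟩
      · exact ⟨d.partner k, by simp, (hC.nbr_mem_circle_iff .below).2 hk⟩
      · exact ⟨c'.partner k, rfl, (hC.nbr_mem_circle_iff .above).2 hk⟩)
  have h2 := hC.circle_induction (v := i)
    (P := fun k => up k ∈ (Stacked.mk c d c' ∅).diagram.circle (up i))
    (Diagram.self_mem_circle _ _) (by
      rintro (_ | _) k - hk
      · change up (d.partner k) ∈ _
        simpa using (hE.nbr_mem_circle_iff .below).2 hk
      · exact (hE.nbr_mem_circle_iff .above).2 hk)
  refine le_antisymm ?_ (Diagram.le_base _ (h2 _ (Diagram.base_mem_circle _ _)))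
  obtain ⟨k, hk, hk'⟩ := h1 _ (Diagram.base_mem_circle _ _)
  rw [hk, ← not_lt, up_lt_up, not_lt]
  exact Diagram.le_base _ hk'

theorem coeff_empty (c d c' : CupDiagram K) (u v : Weight K) :
    (Stacked.mk c d c' ∅).diagram.coeff (glue u v) =
      (circleDiagram c d).coeff u * (circleDiagram d c').coeff v := by
  rw [(valid_empty c d c').alternating.coeff_eq, (circleDiagram_alternating c d).coeff_eq,
    (circleDiagram_alternating d c').coeff_eq, prod_stackedVertex]
  simp only [base_lo_empty, base_up_empty, lo_injective, up_injective, glue_lo, glue_up]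
  rfl

/-- With all middle strands vertical, the circles are those of `circleDiagram c c'` with every
vertex doubled. The upper copy is the larger one in the order, so base points lie on the upper line
and are not counted twice in `coeff_univ`. -/
theorem base_univ (c d c' : CupDiagram K) (i : Fin (2 * K)) (x : StackedVertex K)
    (hx : x = lo i ∨ x = up i) :
    (Stacked.mk c d c' Finset.univ).diagram.base x = up ((circleDiagram c c').base i) := by
  have hE := (valid_univ c d c').alternating
  have hC := circleDiagram_alternating c c'
  have hlu : ∀ {k y}, lo k ∈ (Stacked.mk c d c' Finset.univ).diagram.circle y ↔
      up k ∈ (Stacked.mk c d c' Finset.univ).diagram.circle y := by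
    intro k y
    simpa using (hE.nbr_mem_circle_iff .above (v := lo k) (w := y)).symm
  have h1 := hE.circle_induction (v := x)
    (P := fun w => ∃ k, (w = lo k ∨ w = up k) ∧ k ∈ (circleDiagram c c').circle i)
    ⟨i, hx, Diagram.self_mem_circle _ _⟩ (by
      rintro (_ | _) w - ⟨k, rfl | rfl, hk⟩
      · exact ⟨c.partner k, Or.inl rfl, (hC.nbr_mem_circle_iff .below).2 hk⟩
      · exact ⟨k, Or.inl (by simp), hk⟩
      · exact ⟨k, Or.inr (by simp), hk⟩
      · exact ⟨c'.partner k, Or.inr rfl, (hC.nbr_mem_circle_iff .above).2 hk⟩)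
  have h0 : up i ∈ (Stacked.mk c d c' Finset.univ).diagram.circle x := by
    rcases hx with rfl | rfl
    · exact hlu.1 (Diagram.self_mem_circle _ _)
    · exact Diagram.self_mem_circle _ _
  have h2 := hC.circle_induction (v := i)
    (P := fun k => up k ∈ (Stacked.mk c d c' Finset.univ).diagram.circle x) h0 (by
      rintro (_ | _) k - hk
      · exact hlu.1 ((hE.nbr_mem_circle_iff .below).2 (hlu.2 hk))
      · exact (hE.nbr_mem_circle_iff .above).2 hk)
  refine le_antisymm ?_ (Diagram.le_base _ (h2 _ (Diagram.base_mem_circle _ _)))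
  obtain ⟨k, hk, hk'⟩ := h1 _ (Diagram.base_mem_circle _ _)
  have hle : up k ≤ up ((circleDiagram c c').base i) := by
    rw [← not_lt, up_lt_up, not_lt]
    exact Diagram.le_base _ hk'
  rcases hk with hk | hk
  · rw [hk]
    exact le_trans (by simp [lo, up, Prod.Lex.toLex_le_toLex]) hle
  · rw [hk]
    exact hle

theorem coeff_univ (c d c' : CupDiagram K) (w : Weight K) :
    (Stacked.mk c d c' Finset.univ).diagram.coeff (glue w w) = (circleDiagram c c').coeff w := by
  rw [(valid_univ c d c').alternating.coeff_eq, (circleDiagram_alternating c c').coeff_eq,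
    prod_stackedVertex]
  simp only [base_univ c d c' _ _ (Or.inl rfl), base_univ c d c' _ _ (Or.inr rfl), up_ne_lo,
    false_and, if_false, Finset.prod_const_one, one_mul, up_injective, glue_up]
  rfl

theorem structureConstant_mul_coeff {c d c' : CupDiagram K} {u v : Weight K}
    (hcu : c.OrientedBy u) (hdu : d.OrientedBy u) (hdv : d.OrientedBy v) (hcv : c'.OrientedBy v)
    (w : Weight K) :
    structureConstant arcSigns c d c' u v w * (circleDiagram c c').coeff w =
      (circleDiagram c d).coeff u * (circleDiagram d c').coeff v *
        structureConstant adjustedSigns c d c' u v w := by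
  rw [← coeff_univ c d c' w, ← coeff_empty]
  refine surgeries_mul_coeff K (valid_empty c d c') (by simp) _ _ _ ?_ ?_ _
  · intro o ho
    obtain rfl : o = glue u v := by
      by_contra h
      exact ho (if_neg h)
    exact isOrientation_glue hcu hdu hdv hcv
  · intro o
    split_ifs with h
    · rw [h, one_mul, mul_one]
    · simp

/-! ### Structure constants of the two algebras -/

theorem blockProduct_apply (σ : SignRule) {B : Block} (x y z : OrientedCircleDiagram B) :
    blockProduct σ x y z = if x.cap = y.cup ∧ z.cup = x.cup ∧ z.cap = y.cap then
      structureConstant σ x.cup x.cap y.cap x.weight y.weight z.weight else 0 := by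
  classical
  unfold blockProduct
  by_cases h1 : x.cap = y.cup
  swap
  · simp [h1]
  rw [if_pos h1, Finsupp.finsetSum_apply, Finset.sum_eq_single z.weight]
  · by_cases h2 : z.cup = x.cup ∧ z.cap = y.cap
    · have h3 : Quot.mk LinkageMove z.weight = B.2 ∧ x.cup.OrientedBy z.weight ∧
          y.cap.OrientedBy z.weight :=
        ⟨z.weight_mem, h2.1 ▸ z.cup_oriented, h2.2 ▸ z.cap_oriented⟩
      rw [dif_pos h3, if_pos ⟨h1, h2⟩, Finsupp.single_apply, if_pos]
      exact OrientedCircleDiagram.ext h2.1.symm h2.2.symm rfl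
    · rw [if_neg fun h => h2 h.2]
      split_ifs with h3
      · rw [Finsupp.single_apply, if_neg]
        intro e
        exact h2 (by rw [← e]; exact ⟨rfl, rfl⟩)
      · rfl
  · intro w _ hw
    split_ifs with h3
    · rw [Finsupp.single_apply, if_neg]
      intro e
      exact hw (by rw [← e])
    · rfl
  · exact fun h => absurd (Finset.mem_univ _) h

theorem blockProduct_mul_signCoeff {B : Block} (x y z : OrientedCircleDiagram B) :
    blockProduct arcSigns x y z * z.signCoeff =
      x.signCoeff * y.signCoeff * blockProduct adjustedSigns x y z := by
  rw [blockProduct_apply, blockProduct_apply]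
  split_ifs with h
  · obtain ⟨h1, h2, h3⟩ := h
    rw [OrientedCircleDiagram.signCoeff, OrientedCircleDiagram.signCoeff,
      OrientedCircleDiagram.signCoeff, h2, h3, ← h1]
    exact structureConstant_mul_coeff x.cup_oriented x.cap_oriented
      (h1 ▸ y.cup_oriented) y.cap_oriented _
  · simp

theorem fullProduct_mul_signCoeff (x y z : Σ B : Block, OrientedCircleDiagram B) :
    fullProduct arcSigns x y z * z.2.signCoeff =
      x.2.signCoeff * y.2.signCoeff * fullProduct adjustedSigns x y z := by
  obtain ⟨B, x⟩ := x
  obtain ⟨B', y⟩ := y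
  unfold fullProduct
  by_cases h : B' = B
  · subst h
    simp only [dif_pos]
    by_cases hz : z ∈ Set.range (Function.Embedding.sigmaMk (β := OrientedCircleDiagram) B')
    · obtain ⟨z, rfl⟩ := hz
      rw [Finsupp.embDomain_apply_self, Finsupp.embDomain_apply_self]
      exact blockProduct_mul_signCoeff x y z
    · rw [Finsupp.embDomain_of_notMem_range _ _ _ hz, Finsupp.embDomain_of_notMem_range _ _ _ hz]
      simp
  · simp [h]

theorem OrientedCircleDiagram.signCoeff_mul_self {B : Block} (x : OrientedCircleDiagram B) :
    x.signCoeff * x.signCoeff = 1 := by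
  rw [signCoeff, (circleDiagram_alternating _ _).coeff_eq, ← Finset.prod_mul_distrib]
  refine Finset.prod_eq_one fun v _ => ?_
  split_ifs
  · rw [neg_mul_neg, ← mul_pow]; simp
  · rfl

/-! ### Rescaling the basis of an algebra by signs -/

namespace BasedAlgebra

variable {𝕜 : Type*} [CommRing 𝕜] {I : Type*} {m m' : I → I → I →₀ ℤ}

/-- Multiply each basis vector by a scalar. -/
noncomputable def rescale (𝕜 : Type*) [CommRing 𝕜] {I : Type*} (e : I → ℤ) :
    (I →₀ 𝕜) →ₗ[𝕜] (I →₀ 𝕜) :=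
  Finsupp.linearCombination 𝕜 fun x => Finsupp.single x (e x : 𝕜)

theorem rescale_single (e : I → ℤ) (x : I) (a : 𝕜) :
    rescale 𝕜 e (Finsupp.single x a) = Finsupp.single x (a * e x) := by
  simp [rescale]

theorem rescale_apply (e : I → ℤ) (f : I →₀ 𝕜) (x : I) : rescale 𝕜 e f x = f x * e x := by
  classical
  induction f using Finsupp.induction_linear with
  | zero => simp
  | add f g hf hg => simp [hf, hg, add_mul]
  | single y a =>
    rw [rescale_single, Finsupp.single_apply, Finsupp.single_apply]
    split_ifs with h
    · rw [h]
    · simp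

theorem rescale_mulBilin {e : I → ℤ} (hm : ∀ x y z, m x y z * e z = e x * e y * m' x y z)
    (f g : I →₀ 𝕜) :
    rescale 𝕜 e (mulBilin m f g) = mulBilin m' (rescale 𝕜 e f) (rescale 𝕜 e g) := by
  induction f using Finsupp.induction_linear with
  | zero => simp
  | add f f' hf hf' => simp [hf, hf']
  | single x a =>
    induction g using Finsupp.induction_linear with
    | zero => simp
    | add g g' hg hg' => simp [hg, hg']
    | single y b =>
      rw [rescale_single, rescale_single]
      ext z
      rw [rescale_apply]
      have := congrArg (Int.cast : ℤ → 𝕜) (hm x y z)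
      push_cast at this
      simp only [mulBilin, Finsupp.linearCombination_single, LinearMap.smul_apply,
        Finsupp.smul_apply, Finsupp.mapRange_apply, smul_eq_mul]
      linear_combination a * b * this

/-- Rescaling the basis vectors by signs is an isomorphism of graded algebras, if the structure
constants are rescaled accordingly. -/
theorem exists_rescale {e : I → ℤ} (he : ∀ x, e x * e x = 1)
    (hm : ∀ x y z, m x y z * e z = e x * e y * m' x y z) (deg : I → ℕ) :
    ∃ sgn : BasedAlgebra 𝕜 m →ₙₐ[𝕜] BasedAlgebra 𝕜 m', Function.Bijective sgn ∧
      (∀ n : ℤ, (homogeneous deg n).map (sgn : BasedAlgebra 𝕜 m →ₗ[𝕜] BasedAlgebra 𝕜 m') =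
        homogeneous deg n) ∧
      ∀ x : I, sgn (basisElt x) = (e x : 𝕜) • basisElt x := by
  have he' : ∀ x, (e x : 𝕜) * e x = 1 := fun x => by
    exact_mod_cast congrArg (Int.cast : ℤ → 𝕜) (he x)
  have hinv : ∀ f : I →₀ 𝕜, rescale 𝕜 e (rescale 𝕜 e f) = f := by
    intro f
    ext x
    rw [rescale_apply, rescale_apply, mul_assoc, he', mul_one]
  let sgn : BasedAlgebra 𝕜 m →ₙₐ[𝕜] BasedAlgebra 𝕜 m' :=
    { toFun := fun x => ⟨rescale 𝕜 e x.coord⟩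
      map_smul' := fun a x => coord_injective ((rescale 𝕜 e).map_smul a x.coord)
      map_zero' := coord_injective (rescale 𝕜 e).map_zero
      map_add' := fun x y => coord_injective ((rescale 𝕜 e).map_add x.coord y.coord)
      map_mul' := fun x y => coord_injective (rescale_mulBilin hm x.coord y.coord) }
  have hbasis : ∀ x : I, sgn (basisElt x) = (e x : 𝕜) • basisElt x := by
    intro x
    apply coord_injective
    change rescale 𝕜 e (Finsupp.single x 1) = (e x : 𝕜) • Finsupp.single x 1
    rw [rescale_single]
    simp
  refine ⟨sgn, ⟨fun x y h => coord_injective ?_, fun y => ⟨⟨rescale 𝕜 e y.coord⟩, ?_⟩⟩, ?_, hbasis⟩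
  · have h' : rescale 𝕜 e x.coord = rescale 𝕜 e y.coord := congrArg coord h
    rw [← hinv x.coord, h', hinv]
  · exact coord_injective (hinv y.coord)
  · intro n
    apply le_antisymm
    · rw [homogeneous, Submodule.map_span, Submodule.span_le]
      rintro _ ⟨_, ⟨x, hx, rfl⟩, rfl⟩
      change sgn (basisElt x) ∈ _
      rw [hbasis]
      exact Submodule.smul_mem _ _ (Submodule.subset_span ⟨x, hx, rfl⟩)
    · rw [homogeneous, Submodule.span_le]
      rintro _ ⟨x, hx, rfl⟩
      refine ⟨(e x : 𝕜) • basisElt x,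
        Submodule.smul_mem _ _ (Submodule.subset_span ⟨x, hx, rfl⟩), ?_⟩
      change sgn ((e x : 𝕜) • basisElt x) = _
      rw [map_smul, hbasis, smul_smul, he', one_smul]

end BasedAlgebra

end TypeD

theorem proposition4p3 (𝕜 : Type*) [Field 𝕜] :
    -- the isomorphism on the summand of each block
    (∀ B : TypeD.Block,
      ∃ sgn : TypeD.BlockArcAlgebra 𝕜 B →ₙₐ[𝕜] TypeD.AdjustedBlockArcAlgebra 𝕜 B,
        Function.Bijective sgn ∧
        (∀ n : ℤ,
          (TypeD.BasedAlgebra.homogeneous TypeD.OrientedCircleDiagram.degree n).map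
              (sgn : TypeD.BlockArcAlgebra 𝕜 B →ₗ[𝕜] TypeD.AdjustedBlockArcAlgebra 𝕜 B) =
            TypeD.BasedAlgebra.homogeneous TypeD.OrientedCircleDiagram.degree n) ∧
        ∀ x : TypeD.OrientedCircleDiagram B,
          sgn (TypeD.BasedAlgebra.basisElt x) =
            (x.signCoeff : 𝕜) • TypeD.BasedAlgebra.basisElt x) ∧
    -- the isomorphism on the full algebra
    ∃ sgn : TypeD.ArcAlgebra 𝕜 →ₙₐ[𝕜] TypeD.AdjustedArcAlgebra 𝕜,
      Function.Bijective sgn ∧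
      (∀ n : ℤ,
        (TypeD.BasedAlgebra.homogeneous (fun x => x.2.degree) n).map
            (sgn : TypeD.ArcAlgebra 𝕜 →ₗ[𝕜] TypeD.AdjustedArcAlgebra 𝕜) =
          TypeD.BasedAlgebra.homogeneous (fun x => x.2.degree) n) ∧
      ∀ x : Σ B : TypeD.Block, TypeD.OrientedCircleDiagram B,
        sgn (TypeD.BasedAlgebra.basisElt x) =
          (x.2.signCoeff : 𝕜) • TypeD.BasedAlgebra.basisElt x := by
  exact ⟨fun _ => TypeD.BasedAlgebra.exists_rescale
      TypeD.OrientedCircleDiagram.signCoeff_mul_self TypeD.blockProduct_mul_signCoeff _,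
    TypeD.BasedAlgebra.exists_rescale
      (e := fun x : Σ B : TypeD.Block, TypeD.OrientedCircleDiagram B => x.2.signCoeff)
      (fun x => TypeD.OrientedCircleDiagram.signCoeff_mul_self x.2) TypeD.fullProduct_mul_signCoeff _⟩
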